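/- Let $G=(V,E)$ be a finite simple graph with $n$ vertices and $m$ edges, let $q>1$ and $p\in(0,1)$. For $A\subseteq E$ let $c(A)$ be the number of connected components of $(V,A)$ (isolated vertices included), and let $$\mu(A)=\frac1Z\,p^{|A|}(1-p)^{|E|-|A|}q^{c(A)},\qquad Z=\sum_{A\subseteq E}p^{|A|}(1-p)^{|E|-|A|}q^{c(A)},$$ be the random-cluster measure on the subsets of $E$. Consider two Markov chains on the subsets of $E$. * The heat-bath Glauber dynamics (GD): from $A$, pick $e\in E$ uniformly at random; move to $A\cup\{e\}$ with probability $\mu(A\cup\{e\})/(\mu(A\cup\{e\})+\mu(A\setminus\{e\}))$, and otherwise to $A\setminus\{e\}$. * The Chayes--Machta dynamics (CM): from $A$, activate each connected component of $(V,A)$ independently with probability $1/q$; remove all edges joining two active vertices; then add each edge of $G$ joining two active vertices independently with probability $p$, leaving the rest of the configuration unchanged. For a chain $P$ among these let $$\tau_{\mathrm{mix}}(P)=\max_{A\subseteq E}\ \min\bigl\{t\ge 0:\ \|P^t(A,\cdot)-\mu\|_{\mathrm{TV}}\le \tfrac14\bigr\},$$ where $\|\cdot\|_{\mathrm{TV}}$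 is the total variation distance. Theorem. There is an absolute constant $C>0$ (independent of $G$, $n$, $m$, $p$ and $q$) such that for every finite simple graph $G$ with $n$ vertices and $m$ edges, every real $q>1$ and every $p\in(0,1)$, $$\tau_{\mathrm{mix}}(\mathrm{GD})\ \le\ C\Bigl(m\,n\log n+p\,m^2\log n\cdot\log\frac1{\min\{p,1-p\}}\Bigr)\cdot\tau_{\mathrm{mix}}(\mathrm{CM}).$$ -/

import Mathlib

open scoped ENNReal

noncomputable section

namespace RandomCluster

/-- Total variation distance between two distributions on a finite set. -/
def tvDist {Ω : Type*} [Fintype Ω] (a b : Ω → ℝ) : ℝ :=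
  (1 / 2) * ∑ x, |a x - b x|

/-- The `ε`-mixing time of a chain with transition matrix `P` and stationary distribution `π`:
the maximum over starting states `x` of the least `t ≥ 0` with `‖P ^ t (x, ·) - π‖_TV ≤ ε`.
It takes values in `ℕ∞`, and is `⊤` when the distance to `π` never drops to `ε`
from some starting state. -/
def mixingTime {Ω : Type*} [Fintype Ω] [DecidableEq Ω]
    (P : Matrix Ω Ω ℝ) (π : Ω → ℝ) (ε : ℝ) : ℕ∞ :=
  ⨆ x : Ω, ⨅ (t : ℕ) (_ : tvDist (fun y => (P ^ t) x y) π ≤ ε), (t : ℕ∞)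

section Model

variable {V : Type*} [Fintype V] [DecidableEq V] (G : SimpleGraph V) [DecidableRel G.Adj]

/-- Random-cluster configurations: all subsets of the edge set of `G`. -/
abbrev Config : Type _ := Finset G.edgeSet

variable {G}

/-- The spanning subgraph `(V, A)` of `G`. -/
def subgraphOf (A : Config G) : SimpleGraph V :=
  SimpleGraph.fromEdgeSet (Subtype.val '' (A : Set G.edgeSet))

/-- The connected components of `(V, A)`; isolated vertices are components. -/
abbrev Component (A : Config G) : Type _ := (subgraphOf A).ConnectedComponent

/-- The number `c(A)` of connected components of `(V, A)`. -/
def numComponents (A : Config G) : ℕ := Nat.card (Component A)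

/-- The unnormalized weight `p ^ |A| (1 - p) ^ (|E| - |A|) q ^ c(A)`. -/
def weight (p q : ℝ) (A : Config G) : ℝ :=
  p ^ A.card * (1 - p) ^ (Aᶜ).card * q ^ numComponents A

variable (G)

/-- The partition function `Z(G, p, q)`. -/
def partitionFunction (p q : ℝ) : ℝ := ∑ A : Config G, weight p q A

/-- The random-cluster measure `μ_{G,p,q}`. -/
def rcMeasure (p q : ℝ) (A : Config G) : ℝ := weight p q A / partitionFunction G p q

/-- The heat-bath Glauber dynamics: pick an edge `e` uniformly at random, move from `A` to `A ∪ {e}`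
with probability `μ(A ∪ {e}) / (μ(A ∪ {e}) + μ(A \ {e}))`, and to `A \ {e}` otherwise. -/
def glauber (p q : ℝ) : Matrix (Config G) (Config G) ℝ := fun A B =>
  ∑ e : G.edgeSet, (1 / (Fintype.card G.edgeSet : ℝ)) *
    (let r := rcMeasure G p q (insert e A) /
        (rcMeasure G p q (insert e A) + rcMeasure G p q (A.erase e))
     (if B = insert e A then r else 0) + (if B = A.erase e then 1 - r else 0))

variable {G}

open Classical in
/-- The edges of `G` both of whose endpoints are active, when the components of `(V, A)` that
belong to `S` are active. -/
def activeEdges (A : Config G) (S : Finset (Component A)) : Config G :=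
  Finset.univ.filter fun e => ∀ v ∈ (e : Sym2 V), (subgraphOf A).connectedComponentMk v ∈ S

variable (G)

open Classical in
/-- The Chayes–Machta dynamics: each connected component of `(V, A)` is activated independently
with probability `1 / q` (`S` is the set of activated components); all edges between active
vertices are removed and each edge of `G` between active vertices is then added independently
with probability `p`; all other edges keep their state. -/
def chayesMachta (p q : ℝ) : Matrix (Config G) (Config G) ℝ := fun A B =>
  ∑ S : Finset (Component A),
    ((1 / q) ^ S.card * (1 - 1 / q) ^ (Sᶜ).card) *
      (if B \ activeEdges A S = A \ activeEdges A S then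
        p ^ (B ∩ activeEdges A S).card * (1 - p) ^ (activeEdges A S \ B).card
      else 0)

end Model

end RandomCluster

end

/-! The Dirichlet forms of the two chains are compared, and the resulting spectral gap of GD is
turned into a mixing bound by an L² estimate started from configurations of not too small weight.

Let W be the random set of active vertices in a CM step. The factor q^c(A) times the probability of
W given A is (q-1) to the number of inactive components (or 0 if W is not a union of components),
and edges inside W do not affect this. So, given W and the edges not inside W, the edges inside W
are independent Bernoulli(p) (`jointWeight_insert`), and CM is an average over W of product-measure
resamplings. Efron–Stein bounds its Dirichlet form by single-edge terms. An edge that is present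
lies inside W with probability exactly 1/q, and heat-bath insertion probabilities are at most p;
hence E_CM ≤ (m/q) E_GD (`dirichlet_comparison`). If CM has mixed at time τ ≥ 1, its gap is at least
1/(2τ) (`gap_of_tvDist`), so that of GD is at least q/(2mτ).

The L² bound costs log(1/μ(A)), which is too large for dense A when p is small. A burn-in of m
log(16m) steps brings |A| below 16pm with probability 7/8 (`glauber_burnIn`). For such A,
log(1/μ(A)) ≤ nq + 20pmL with L = log(1/min{p,1-p}) (`exp_le_rcMeasure`). Dividing by the gap
cancels q, so the final bound is uniform in q. -/

noncomputable section

namespace RandomCluster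

/-! ### Reversible chains: total variation, spectral gap and L² decay. -/

section Chain

variable {Ω : Type*} [Fintype Ω]

/-- The weighted inner product `∑ x, w x * f x * g x`. -/
def wip (w f g : Ω → ℝ) : ℝ := ∑ x, w x * f x * g x

lemma wip_comm (w f g : Ω → ℝ) : wip w f g = wip w g f :=
  Finset.sum_congr rfl fun _ _ => by ring

lemma wip_add_right (w f g h : Ω → ℝ) : wip w f (g + h) = wip w f g + wip w f h := by
  simp only [wip, Pi.add_apply, mul_add, Finset.sum_add_distrib]

lemma wip_sub_right (w f g h : Ω → ℝ) : wip w f (g - h) = wip w f g - wip w f h := by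
  simp only [wip, Pi.sub_apply, mul_sub, Finset.sum_sub_distrib]

lemma wip_sub_left (w f g h : Ω → ℝ) : wip w (f - g) h = wip w f h - wip w g h := by
  rw [wip_comm, wip_sub_right, wip_comm, wip_comm w h]

lemma wip_self_nonneg {w : Ω → ℝ} (hw : ∀ x, 0 ≤ w x) (f : Ω → ℝ) : 0 ≤ wip w f f :=
  Finset.sum_nonneg fun x _ => by rw [mul_assoc]; exact mul_nonneg (hw x) (mul_self_nonneg _)

lemma wip_sq_le {w : Ω → ℝ} (hw : ∀ x, 0 ≤ w x) (f g : Ω → ℝ) :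
    wip w f g ^ 2 ≤ wip w f f * wip w g g := by
  have h := Finset.sum_mul_sq_le_sq_mul_sq Finset.univ
    (fun x => Real.sqrt (w x) * f x) (fun x => Real.sqrt (w x) * g x)
  have e : ∀ (a b : Ω → ℝ), wip w a b
      = ∑ x, (Real.sqrt (w x) * a x) * (Real.sqrt (w x) * b x) := fun a b =>
    Finset.sum_congr rfl fun x _ => by
      have := Real.mul_self_sqrt (hw x)
      linear_combination (-(a x * b x)) * this
  rw [e f g, e f f, e g g]
  simpa only [sq] using h

/-- Detailed balance. -/
def Reversible (w : Ω → ℝ) (P : Matrix Ω Ω ℝ) : Prop :=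
  ∀ x y, w x * P x y = w y * P y x

lemma Reversible.wip_mulVec {w : Ω → ℝ} {P : Matrix Ω Ω ℝ} (h : Reversible w P) (f g : Ω → ℝ) :
    wip w f (P.mulVec g) = wip w (P.mulVec f) g := by
  simp only [wip, Matrix.mulVec, dotProduct, Finset.mul_sum, Finset.sum_mul]
  rw [Finset.sum_comm]
  refine Finset.sum_congr rfl fun x _ => Finset.sum_congr rfl fun y _ => ?_
  linear_combination (f y * g x) * h y x

variable [DecidableEq Ω]

lemma reversible_of_wip {w : Ω → ℝ} {P : Matrix Ω Ω ℝ}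
    (h : ∀ f g, wip w f (P.mulVec g) = wip w (P.mulVec f) g) : Reversible w P := by
  intro x y
  have := h (Pi.single x 1) (Pi.single y 1)
  simpa [wip, Pi.single_apply, Matrix.mulVec, dotProduct] using this

lemma Reversible.pow {w : Ω → ℝ} {P : Matrix Ω Ω ℝ} (h : Reversible w P) (k : ℕ) :
    Reversible w (P ^ k) := by
  refine reversible_of_wip ?_
  induction k with
  | zero => intro f g; simp
  | succ k ih =>
    intro f g
    rw [pow_succ, ← Matrix.mulVec_mulVec, ih, h.wip_mulVec, Matrix.mulVec_mulVec, ← pow_succ',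
      ← pow_succ]

/-- A reversible stochastic matrix with its stationary distribution. -/
structure RevChain (w : Ω → ℝ) (P : Matrix Ω Ω ℝ) : Prop where
  pos : ∀ x, 0 < w x
  sum_one : ∑ x, w x = 1
  nonneg : ∀ x y, 0 ≤ P x y
  row_sum : ∀ x, ∑ y, P x y = 1
  rev : Reversible w P

namespace RevChain

variable {w : Ω → ℝ} {P : Matrix Ω Ω ℝ}

lemma pow (h : RevChain w P) (k : ℕ) : RevChain w (P ^ k) := by
  have hP : P ^ k ∈ Matrix.rowStochastic ℝ Ω :=
    pow_mem (Matrix.mem_rowStochastic_iff_sum.2 ⟨h.nonneg, h.row_sum⟩) k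
  exact ⟨h.pos, h.sum_one, fun _ _ => (Matrix.mem_rowStochastic_iff_sum.1 hP).1 _ _,
    (Matrix.mem_rowStochastic_iff_sum.1 hP).2, h.rev.pow k⟩

omit [DecidableEq Ω] in
lemma stationary (h : RevChain w P) (y : Ω) : ∑ x, w x * P x y = w y := by
  rw [Finset.sum_congr rfl fun x _ => h.rev x y, ← Finset.mul_sum, h.row_sum, mul_one]

omit [DecidableEq Ω] in
lemma sum_mulVec (h : RevChain w P) (f : Ω → ℝ) :
    ∑ x, w x * P.mulVec f x = ∑ x, w x * f x := by
  simp only [Matrix.mulVec, dotProduct, Finset.mul_sum]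
  rw [Finset.sum_comm]
  refine Finset.sum_congr rfl fun y _ => ?_
  rw [← h.stationary y, Finset.sum_mul]
  exact Finset.sum_congr rfl fun x _ => by ring

lemma sum_pow_mulVec (h : RevChain w P) (k : ℕ) (f : Ω → ℝ) :
    ∑ x, w x * (P ^ k).mulVec f x = ∑ x, w x * f x := (h.pow k).sum_mulVec f

omit [DecidableEq Ω] in
-- Since `w` is stationary, one more step applies `P` to the signed measure `Q x - w`, and a
-- stochastic matrix contracts ℓ¹.
lemma tvDist_mul_le (h : RevChain w P) (Q : Matrix Ω Ω ℝ) (x : Ω) :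
    tvDist (fun y => (Q * P) x y) w ≤ tvDist (fun y => Q x y) w := by
  unfold tvDist
  refine mul_le_mul_of_nonneg_left ?_ (by norm_num)
  calc ∑ y, |(Q * P) x y - w y| = ∑ y, |∑ z, (Q x z - w z) * P z y| := by
        refine Finset.sum_congr rfl fun y _ => ?_
        rw [← h.stationary y, Matrix.mul_apply, ← Finset.sum_sub_distrib]
        simp only [sub_mul]
    _ ≤ ∑ y, ∑ z, |Q x z - w z| * P z y := by
        refine Finset.sum_le_sum fun y _ => (Finset.abs_sum_le_sum_abs _ _).trans_eq ?_
        exact Finset.sum_congr rfl fun z _ => by rw [abs_mul, abs_of_nonneg (h.nonneg z y)]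
    _ = ∑ z, |Q x z - w z| := by
        rw [Finset.sum_comm]
        exact Finset.sum_congr rfl fun z _ => by rw [← Finset.mul_sum, h.row_sum, mul_one]

lemma tvDist_pow_antitone (h : RevChain w P) {s t : ℕ} (hst : s ≤ t) (x : Ω) :
    tvDist (fun y => (P ^ t) x y) w ≤ tvDist (fun y => (P ^ s) x y) w := by
  obtain ⟨k, rfl⟩ := Nat.exists_eq_add_of_le hst
  rw [pow_add]
  exact (h.pow k).tvDist_mul_le _ x

/-- A uniform bound on the mixing time in terms of the distance at a single time. -/
lemma mixingTime_le {ε : ℝ} {t : ℕ} (ht : ∀ x, tvDist (fun y => (P ^ t) x y) w ≤ ε) :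
    mixingTime P w ε ≤ t :=
  iSup_le fun x => iInf₂_le t (ht x)

lemma tvDist_le_of_mixingTime_le (h : RevChain w P) {ε : ℝ} {t : ℕ}
    (ht : mixingTime P w ε ≤ t) (x : Ω) : tvDist (fun y => (P ^ t) x y) w ≤ ε := by
  -- The strict bound by `t + 1` makes the infimum witnessed by an actual time `s ≤ t`; monotonicity
  -- then carries the estimate to `t`.
  have hx : (⨅ (s : ℕ) (_ : tvDist (fun y => (P ^ s) x y) w ≤ ε), (s : ℕ∞)) < (t + 1 : ℕ) :=
    ((le_iSup (fun x : Ω => ⨅ (s : ℕ) (_ : tvDist (fun y => (P ^ s) x y) w ≤ ε), (s : ℕ∞))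
      x).trans ht).trans_lt (by exact_mod_cast Nat.lt_succ_self t)
  obtain ⟨s, hs⟩ := iInf_lt_iff.1 hx
  obtain ⟨hs1, hs2⟩ := iInf_lt_iff.1 hs
  have : s ≤ t := Nat.lt_succ_iff.1 (by exact_mod_cast hs2)
  exact (h.tvDist_pow_antitone this x).trans hs1

omit [DecidableEq Ω] in
-- For mean-zero `f` one may subtract `w` from each row; the ℓ¹ norm of the difference is twice the
-- total variation, hence at most 1/2.
lemma abs_mulVec_le (hd : ∀ x, tvDist (fun y => P x y) w ≤ 1 / 4)
    {f : Ω → ℝ} (hf : ∑ x, w x * f x = 0) {M : ℝ} (hM : ∀ x, |f x| ≤ M) (x : Ω) :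
    |P.mulVec f x| ≤ M / 2 := by
  have e : P.mulVec f x = ∑ y, (P x y - w y) * f y := by
    simp only [sub_mul, Finset.sum_sub_distrib, hf, sub_zero, Matrix.mulVec, dotProduct]
  have hM0 : 0 ≤ M := (abs_nonneg _).trans (hM x)
  rw [e]
  calc |∑ y, (P x y - w y) * f y| ≤ ∑ y, |P x y - w y| * M :=
        (Finset.abs_sum_le_sum_abs _ _).trans (Finset.sum_le_sum fun y _ => by
          rw [abs_mul]; exact mul_le_mul_of_nonneg_left (hM y) (abs_nonneg _))
    _ = (2 * tvDist (fun y => P x y) w) * M := by rw [← Finset.sum_mul]; unfold tvDist; ring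
    _ ≤ (2 * (1 / 4)) * M := by gcongr; exact hd x
    _ = M / 2 := by ring

lemma abs_pow_mulVec_le (h : RevChain w P) (hd : ∀ x, tvDist (fun y => P x y) w ≤ 1 / 4)
    {f : Ω → ℝ} (hf : ∑ x, w x * f x = 0) {M : ℝ} (hM : ∀ x, |f x| ≤ M) (k : ℕ) (x : Ω) :
    |(P ^ k).mulVec f x| ≤ M * (1 / 2) ^ k := by
  induction k generalizing x with
  | zero => simpa using hM x
  | succ k ih =>
    rw [pow_succ', ← Matrix.mulVec_mulVec]
    have := abs_mulVec_le hd (f := (P ^ k).mulVec f)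
      ((h.sum_pow_mulVec k f).trans hf) ih x
    rwa [pow_succ, ← mul_assoc, mul_one_div]

/-- Norms of iterates decay no faster than the Rayleigh quotient predicts. -/
lemma rayleigh_pow_le (h : RevChain w P) (f : Ω → ℝ) {ρ : ℝ} (hρ : 0 ≤ ρ)
    (hf : ρ * wip w f f ≤ wip w f (P.mulVec f)) (k : ℕ) :
    ρ ^ (2 * k) * wip w f f ≤ wip w ((P ^ k).mulVec f) ((P ^ k).mulVec f) := by
  have hw : ∀ x, 0 ≤ w x := fun x => (h.pos x).le
  set b : ℕ → ℝ := fun k => wip w ((P ^ k).mulVec f) ((P ^ k).mulVec f) with hb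
  have b0 : ∀ k, 0 ≤ b k := fun k => wip_self_nonneg hw _
  -- Log-convexity of the squared norms (Cauchy–Schwarz and reversibility): the ratios `b (k+1) / b
  -- k` do not decrease, so it suffices that the first is at least `ρ ^ 2`.
  have bconv : ∀ k, b (k + 1) ^ 2 ≤ b k * b (k + 2) := by
    intro k
    have e : b (k + 1) = wip w ((P ^ k).mulVec f) ((P ^ (k + 2)).mulVec f) := by
      simp only [hb]
      rw [show k + 2 = (k + 1) + 1 from rfl, pow_succ' P (k + 1),
        ← Matrix.mulVec_mulVec, h.rev.wip_mulVec, Matrix.mulVec_mulVec, ← pow_succ']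
    rw [e]
    exact wip_sq_le hw _ _
  have step : ∀ k, ρ ^ 2 * b k ≤ b (k + 1) := by
    intro k
    induction k with
    | zero =>
      have h1 := wip_sq_le hw f (P.mulVec f)
      have e0 : b 0 = wip w f f := by simp [hb]
      have e1 : b 1 = wip w (P.mulVec f) (P.mulVec f) := by simp [hb]
      rw [zero_add, e0, e1]
      rcases (wip_self_nonneg hw f).eq_or_lt with h0 | h0
      · rw [← h0, mul_zero]; exact wip_self_nonneg hw _
      · have h2 : (ρ * wip w f f) ^ 2 ≤ wip w f (P.mulVec f) ^ 2 :=
          pow_le_pow_left₀ (mul_nonneg hρ h0.le) hf 2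
        refine le_of_mul_le_mul_left ?_ h0
        nlinarith
    | succ k ih =>
      rcases (b0 (k + 1)).eq_or_lt with h0 | h0
      · rw [← h0, mul_zero]; exact b0 _
      · refine le_of_mul_le_mul_left ?_ h0
        calc b (k + 1) * (ρ ^ 2 * b (k + 1)) = ρ ^ 2 * b (k + 1) ^ 2 := by ring
          _ ≤ ρ ^ 2 * (b k * b (k + 2)) := by gcongr; exact bconv k
          _ = (ρ ^ 2 * b k) * b (k + 2) := by ring
          _ ≤ b (k + 1) * b (k + 2) := by gcongr; exact b0 _
  change ρ ^ (2 * k) * wip w f f ≤ b k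
  induction k with
  | zero => simp [hb]
  | succ k ih =>
    calc ρ ^ (2 * (k + 1)) * wip w f f = ρ ^ 2 * (ρ ^ (2 * k) * wip w f f) := by ring
      _ ≤ ρ ^ 2 * b k := by gcongr
      _ ≤ b (k + 1) := step k

/-- The spectral gap is at least `1 / (2 t)` once the chain has mixed at time `t`. -/
lemma gap_of_tvDist (h : RevChain w P) {t : ℕ} (ht : 1 ≤ t)
    (hd : ∀ x, tvDist (fun y => (P ^ t) x y) w ≤ 1 / 4) {f : Ω → ℝ}
    (hf : ∑ x, w x * f x = 0) :
    wip w f (P.mulVec f) ≤ (1 - 1 / (2 * t)) * wip w f f := by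
  have hw : ∀ x, 0 ≤ w x := fun x => (h.pos x).le
  have ht' : (1 : ℝ) ≤ t := by exact_mod_cast ht
  by_contra! hcon
  have hf0 : 0 < wip w f f := by
    refine (wip_self_nonneg hw f).lt_of_ne fun h0 => ?_
    have hz := wip_sq_le hw f (P.mulVec f)
    rw [← h0, zero_mul] at hz
    have : wip w f (P.mulVec f) = 0 := by nlinarith
    rw [← h0, this, mul_zero] at hcon
    exact lt_irrefl _ hcon
  set ρ := wip w f (P.mulVec f) / wip w f f with hρ
  have hρ1 : 1 - 1 / (2 * (t : ℝ)) < ρ := by rwa [hρ, lt_div_iff₀ hf0]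
  have hbase : (1 : ℝ) / 2 ≤ 1 - 1 / (2 * (t : ℝ)) := by
    have : 1 / (2 * (t : ℝ)) ≤ 1 / 2 := one_div_le_one_div_of_le (by norm_num) (by linarith)
    linarith
  have hρ0 : 0 ≤ ρ := by linarith
  -- Bernoulli's inequality: (1 - 1/(2t))^t ≥ 1/2. A Rayleigh quotient above this threshold
  -- contradicts the halving of sup norms every `t` steps.
  have hρt : 1 / 2 < ρ ^ t := by
    have hb := one_add_mul_le_pow (a := -(1 / (2 * (t : ℝ)))) (by linarith) t
    have e : 1 + (t : ℝ) * -(1 / (2 * (t : ℝ))) = 1 / 2 := by field_simp; norm_num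
    rw [e, ← sub_eq_add_neg] at hb
    exact hb.trans_lt (pow_lt_pow_left₀ hρ1 (by linarith) (by omega))
  obtain ⟨M, hM⟩ : ∃ M, ∀ x, |f x| ≤ M := by
    obtain ⟨M, hM⟩ := (Set.finite_range fun x => |f x|).bddAbove
    exact ⟨M, fun x => hM ⟨x, rfl⟩⟩
  have key : ∀ k : ℕ, ((2 * ρ ^ t) ^ 2) ^ k ≤ M ^ 2 / wip w f f := by
    intro k
    have h1 := h.rayleigh_pow_le f hρ0 (by rw [hρ, div_mul_cancel₀ _ hf0.ne']) (t * k)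
    have h2 := (h.pow t).abs_pow_mulVec_le hd hf hM k
    have h3 : wip w ((P ^ (t * k)).mulVec f) ((P ^ (t * k)).mulVec f)
        ≤ (M * (1 / 2) ^ k) ^ 2 := by
      calc _ ≤ ∑ x, w x * (M * (1 / 2) ^ k) ^ 2 := by
            refine Finset.sum_le_sum fun x _ => ?_
            rw [mul_assoc, ← sq]
            refine mul_le_mul_of_nonneg_left ?_ (hw x)
            rw [pow_mul]
            exact sq_le_sq' (abs_le.1 (h2 x)).1 (abs_le.1 (h2 x)).2
        _ = _ := by rw [← Finset.sum_mul, h.sum_one, one_mul]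
    rw [le_div_iff₀ hf0]
    calc ((2 * ρ ^ t) ^ 2) ^ k * wip w f f
        = 4 ^ k * (ρ ^ (2 * (t * k)) * wip w f f) := by
          rw [mul_pow, mul_pow, show (2 : ℝ) ^ 2 = 4 by norm_num, ← pow_mul ρ, ← pow_mul ρ,
            show t * 2 * k = 2 * (t * k) by ring]
          ring
      _ ≤ 4 ^ k * (M * (1 / 2) ^ k) ^ 2 :=
          mul_le_mul_of_nonneg_left (h1.trans h3) (by positivity)
      _ = M ^ 2 * (4 ^ k * (1 / 4) ^ k) := by
          rw [mul_pow, ← pow_mul, mul_comm k 2, pow_mul]; norm_num; ring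
      _ = M ^ 2 := by rw [← mul_pow]; norm_num
  have h1 : 1 < (2 * ρ ^ t) ^ 2 := by nlinarith
  obtain ⟨k, hk⟩ := pow_unbounded_of_one_lt (M ^ 2 / wip w f f) h1
  exact absurd (key k) (not_le.2 hk)

/-- A mean-square contraction estimate bounds the distance to stationarity. -/
lemma sq_tvDist_le (h : RevChain w P) {c : ℝ} (hc : 0 ≤ c)
    (hP : ∀ f : Ω → ℝ, ∑ x, w x * f x = 0 →
      wip w (P.mulVec f) (P.mulVec f) ≤ c * wip w f f) (k : ℕ) (x : Ω) :
    (2 * tvDist (fun y => (P ^ k) x y) w) ^ 2 ≤ c ^ k / w x := by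
  have hw : ∀ x, 0 ≤ w x := fun x => (h.pos x).le
  have hpow : ∀ (k : ℕ) (f : Ω → ℝ), ∑ x, w x * f x = 0 →
      wip w ((P ^ k).mulVec f) ((P ^ k).mulVec f) ≤ c ^ k * wip w f f := by
    intro k f hf
    induction k with
    | zero => simp
    | succ k ih =>
      rw [pow_succ', ← Matrix.mulVec_mulVec]
      refine (hP _ ((h.sum_pow_mulVec k f).trans hf)).trans ?_
      rw [pow_succ', mul_assoc]
      exact mul_le_mul_of_nonneg_left ih hc
  -- The centred density of the point mass at `x`. By reversibility `P ^ k` maps it to the centred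
  -- density of the law at time `k`, and Cauchy–Schwarz passes from L² to L¹.
  set g : Ω → ℝ := fun y => (if y = x then 1 / w x else 0) - 1 with hg
  have hg0 : ∑ y, w y * g y = 0 := by
    simp [hg, mul_sub, Finset.sum_sub_distrib, h.sum_one, (h.pos x).ne']
  have hgg : wip w g g ≤ 1 / w x := by
    have : wip w g g = ∑ y, (w y * (if y = x then 1 / w x else 0) ^ 2) - 2 * ∑ y, w y * g y
        - ∑ y, w y := by
      unfold wip
      rw [Finset.mul_sum, ← Finset.sum_sub_distrib, ← Finset.sum_sub_distrib]
      exact Finset.sum_congr rfl fun y _ => by simp only [hg]; ring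
    rw [this, hg0, h.sum_one]
    have e : ∑ y, (w y * (if y = x then 1 / w x else 0) ^ 2) = 1 / w x := by
      simp
      have := (h.pos x).ne'
      field_simp
    rw [e]; linarith
  have hval : ∀ y, w y * (P ^ k).mulVec g y = (P ^ k) x y - w y := by
    intro y
    have : (P ^ k).mulVec g y = (P ^ k) y x * (1 / w x) - 1 := by
      simp only [hg, Matrix.mulVec, dotProduct, mul_sub, Finset.sum_sub_distrib, mul_ite, mul_zero,
        Finset.sum_ite_eq', Finset.mem_univ, if_true]
      rw [Finset.sum_congr rfl fun z _ => mul_one _, (h.pow k).row_sum]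
    have hr := h.rev.pow k x y
    have hx := (h.pos x).ne'
    rw [this]
    field_simp
    linear_combination -hr
  have e : 2 * tvDist (fun y => (P ^ k) x y) w = ∑ y, w y * |(P ^ k).mulVec g y| := by
    unfold tvDist
    rw [← mul_assoc, show (2 : ℝ) * (1 / 2) = 1 by norm_num, one_mul]
    exact Finset.sum_congr rfl fun y _ => by rw [← hval, abs_mul, abs_of_pos (h.pos y)]
  have cs := wip_sq_le hw (fun _ => 1) (fun y => |(P ^ k).mulVec g y|)
  have e1 : wip w (fun _ => 1) (fun y => |(P ^ k).mulVec g y|)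
      = ∑ y, w y * |(P ^ k).mulVec g y| := by simp [wip]
  have e2 : wip w (fun _ => (1 : ℝ)) (fun _ => 1) = 1 := by simp [wip, h.sum_one]
  have e3 : wip w (fun y => |(P ^ k).mulVec g y|) (fun y => |(P ^ k).mulVec g y|)
      = wip w ((P ^ k).mulVec g) ((P ^ k).mulVec g) :=
    Finset.sum_congr rfl fun y _ => by rw [mul_assoc, abs_mul_abs_self, ← mul_assoc]
  rw [e1, e2, e3, one_mul] at cs
  rw [e]
  calc _ ≤ _ := cs
    _ ≤ c ^ k * wip w g g := hpow k g hg0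
    _ ≤ c ^ k * (1 / w x) := by gcongr
    _ = c ^ k / w x := by ring

omit [DecidableEq Ω] in
lemma tvDist_le_one (h : RevChain w P) (x : Ω) : tvDist (fun y => P x y) w ≤ 1 := by
  have : ∑ y, |P x y - w y| ≤ ∑ y, (P x y + w y) :=
    Finset.sum_le_sum fun y _ => (abs_sub _ _).trans_eq (by
      rw [abs_of_nonneg (h.nonneg x y), abs_of_pos (h.pos y)])
  rw [Finset.sum_add_distrib, h.row_sum, h.sum_one] at this
  unfold tvDist
  linarith

/-- A burn-in estimate: the distance after `s + t` steps is at most the probability of being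
at a bad state at time `s` plus the distance after `t` steps from good states. -/
lemma tvDist_pow_add_le (h : RevChain w P) (good : Ω → Prop) [DecidablePred good] {s t : ℕ}
    {δ ε : ℝ} (hε : 0 ≤ ε) (x : Ω)
    (hbad : ∑ y with ¬ good y, (P ^ s) x y ≤ δ)
    (hgood : ∀ y, good y → tvDist (fun z => (P ^ t) y z) w ≤ ε) :
    tvDist (fun y => (P ^ (s + t)) x y) w ≤ δ + ε := by
  have hs := h.pow s
  have h1 : tvDist (fun y => (P ^ (s + t)) x y) w
      ≤ ∑ y, (P ^ s) x y * tvDist (fun z => (P ^ t) y z) w := by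
    unfold tvDist
    simp only [Finset.mul_sum]
    rw [Finset.sum_comm]
    refine Finset.sum_le_sum fun z _ => ?_
    have e : (P ^ (s + t)) x z - w z = ∑ y, (P ^ s) x y * ((P ^ t) y z - w z) := by
      simp only [mul_sub, Finset.sum_sub_distrib]
      rw [← Finset.sum_mul, hs.row_sum, one_mul, pow_add, Matrix.mul_apply]
    rw [e]
    calc 1 / 2 * |∑ y, (P ^ s) x y * ((P ^ t) y z - w z)|
        ≤ 1 / 2 * ∑ y, |(P ^ s) x y * ((P ^ t) y z - w z)| := by
          gcongr; exact Finset.abs_sum_le_sum_abs _ _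
      _ = _ := by
          rw [Finset.mul_sum]
          refine Finset.sum_congr rfl fun y _ => ?_
          rw [abs_mul, abs_of_nonneg (hs.nonneg x y)]; ring
  refine h1.trans ?_
  rw [← Finset.sum_filter_not_add_sum_filter Finset.univ good]
  refine add_le_add ?_ ?_
  · refine le_trans (Finset.sum_le_sum fun y _ => ?_) hbad
    -- From bad states only the trivial bound 1 on the distance is used.
    exact mul_le_of_le_one_right (hs.nonneg x y) ((h.pow t).tvDist_le_one y)
  · calc _ ≤ ∑ y with good y, (P ^ s) x y * ε :=
          Finset.sum_le_sum fun y hy => mul_le_mul_of_nonneg_left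
            (hgood y (Finset.mem_filter.1 hy).2) (hs.nonneg x y)
      _ = (∑ y with good y, (P ^ s) x y) * ε := by rw [Finset.sum_mul]
      _ ≤ 1 * ε := by
          gcongr
          rw [← hs.row_sum x]
          exact Finset.sum_le_sum_of_subset_of_nonneg (Finset.filter_subset _ _)
            fun y _ _ => hs.nonneg x y
      _ = ε := one_mul ε

/-- A chain on a nontrivial space has not mixed at time `0`. -/
lemma mixingTime_ne_zero [Nontrivial Ω] (h : RevChain w P) : mixingTime P w (1 / 4) ≠ 0 := by
  intro h0
  have hd := h.tvDist_le_of_mixingTime_le (ε := 1 / 4) (t := 0) (by rw [h0]; exact zero_le)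
  -- At time 0 the distance from `x` is 1 - w x; two states of mass at least 3/4 cannot coexist.
  have key : ∀ x, 3 / 4 ≤ w x := by
    intro x
    have hx := hd x
    have e : ∑ y, |(P ^ 0) x y - w y| = 2 * (1 - w x) := by
      have h1 : w x ≤ 1 := by
        rw [← h.sum_one]
        exact Finset.single_le_sum (fun y _ => (h.pos y).le) (Finset.mem_univ x)
      have h2 : ∑ y ∈ Finset.univ.erase x, |(P ^ 0) x y - w y|
          = ∑ y ∈ Finset.univ.erase x, w y :=
        Finset.sum_congr rfl fun y hy => by
          rw [pow_zero, Matrix.one_apply_ne (Finset.ne_of_mem_erase hy).symm, zero_sub, abs_neg,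
            abs_of_pos (h.pos y)]
      have h3 := Finset.add_sum_erase Finset.univ w (Finset.mem_univ x)
      rw [← Finset.add_sum_erase _ _ (Finset.mem_univ x), h2, pow_zero, Matrix.one_apply_eq,
        abs_of_nonneg (by linarith)]
      rw [h.sum_one] at h3
      linarith
    unfold tvDist at hx
    rw [e] at hx
    linarith
  obtain ⟨x, y, hxy⟩ := exists_pair_ne Ω
  have : w x + w y ≤ 1 := by
    rw [← h.sum_one, ← Finset.sum_pair hxy]
    exact Finset.sum_le_sum_of_subset_of_nonneg (Finset.subset_univ _) fun y _ _ => (h.pos y).le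
  linarith [key x, key y]

end RevChain

end Chain

/-! ### Commuting self-adjoint projections and Efron–Stein. -/

section Projections

variable {Ω : Type*} [Fintype Ω]

/-- Self-adjointness with respect to the weighted inner product. -/
def SelfAdj (w : Ω → ℝ) (T : Module.End ℝ (Ω → ℝ)) : Prop :=
  ∀ f g, wip w f (T g) = wip w (T f) g

lemma SelfAdj.wip_idem {w : Ω → ℝ} {T : Module.End ℝ (Ω → ℝ)} (h : SelfAdj w T)
    (hi : T * T = T) (f : Ω → ℝ) : wip w f (T f) = wip w (T f) (T f) := by
  rw [← h, ← Module.End.mul_apply, hi]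

lemma SelfAdj.wip_idem_le {w : Ω → ℝ} (hw : ∀ x, 0 ≤ w x) {T : Module.End ℝ (Ω → ℝ)}
    (h : SelfAdj w T) (hi : T * T = T) (f : Ω → ℝ) : wip w f (T f) ≤ wip w f f := by
  have h1 := wip_self_nonneg hw (f - T f)
  have h2 := h.wip_idem hi f
  rw [wip_sub_left, wip_sub_right, wip_sub_right, wip_comm w (T f) f] at h1
  linarith

/-- Properties of products of commuting self-adjoint projections, with the Efron–Stein
inequality. -/
lemma efron_stein {E : Type*} [DecidableEq E] {w : Ω → ℝ} (hw : ∀ x, 0 ≤ w x)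
    {T : E → Module.End ℝ (Ω → ℝ)} {K : Finset E → Module.End ℝ (Ω → ℝ)}
    (hcomm : ∀ e e', Commute (T e) (T e')) (hidem : ∀ e, T e * T e = T e)
    (hK0 : K ∅ = 1) (hK : ∀ e D, e ∉ D → K (insert e D) = T e * K D)
    (D : Finset E) (hT : ∀ e ∈ D, SelfAdj w (T e)) :
    (∀ e, Commute (T e) (K D)) ∧ SelfAdj w (K D) ∧ K D * K D = K D ∧
      ∀ f, wip w f (f - K D f) ≤ ∑ e ∈ D, wip w f (f - T e f) := by
  induction D using Finset.induction_on with
  | empty =>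
    rw [hK0]
    refine ⟨fun e => Commute.one_right _, fun f g => rfl, one_mul _, fun f => ?_⟩
    simp [wip]
  | insert e D he ih =>
    obtain ⟨h1, h2, h3, h4⟩ := ih fun e' he' => hT e' (Finset.mem_insert_of_mem he')
    have hTe := hT e (Finset.mem_insert_self _ _)
    rw [hK e D he]
    refine ⟨fun e' => (hcomm e' e).mul_right (h1 e'), fun f g => ?_, ?_, fun f => ?_⟩
    · rw [Module.End.mul_apply, hTe, h2, ← Module.End.mul_apply, ← (h1 e).eq]
    · calc T e * K D * (T e * K D) = T e * (K D * T e) * K D := by noncomm_ring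
        _ = T e * (T e * K D) * K D := by rw [(h1 e).eq]
        _ = (T e * T e) * (K D * K D) := by noncomm_ring
        _ = T e * K D := by rw [hidem, h3]
    · rw [Finset.sum_insert he]
      set g := f - T e f with hg
      have hTg : T e g = 0 := by
        rw [hg, map_sub, ← Module.End.mul_apply, hidem, sub_self]
      -- Telescoping: f - T K f = (f - K f) + K g. Since `g` lies in the kernel of `T e`, which
      -- commutes with `K D`, the last term equals ⟨g, K g⟩ ≤ ⟨g, g⟩ = ⟨f, g⟩.
      have a1 : wip w f (f - (T e * K D) f) = wip w f (f - K D f) + wip w f (K D g) := by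
        rw [← wip_add_right, hg, map_sub, (h1 e).eq, Module.End.mul_apply, sub_add_sub_cancel]
      have a2 : wip w f (K D g) = wip w g (K D g) := by
        have : wip w (T e f) (K D g) = 0 := by
          rw [← hTe, ← Module.End.mul_apply, (h1 e).eq, Module.End.mul_apply, hTg, map_zero]
          simp [wip]
        rw [hg, wip_sub_left, ← hg, this, sub_zero]
      have a3 : wip w g g = wip w f g := by
        have : wip w (T e f) g = 0 := by
          rw [← hTe, hTg]; simp [wip]
        nth_rewrite 1 [hg]
        rw [wip_sub_left, this, sub_zero]
      have a4 := h2.wip_idem_le hw h3 g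
      have a5 := h4 f
      linarith

end Projections

/-! ### Single-site averaging and product resampling on subsets. -/

section HeatBath

variable {E : Type*} [DecidableEq E]

/-- The operator resampling the state of `e`, which becomes present with probability `r A`. -/
def siteAvg (r : Finset E → ℝ) (e : E) : Module.End ℝ (Finset E → ℝ) where
  toFun f A := r A * f (insert e A) + (1 - r A) * f (A.erase e)
  map_add' f g := by funext A; simp only [Pi.add_apply]; ring
  map_smul' c f := by
    funext A; simp only [Pi.smul_apply, smul_eq_mul, RingHom.id_apply]; ring

lemma siteAvg_apply (r : Finset E → ℝ) (e : E) (f : Finset E → ℝ) (A : Finset E) :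
    siteAvg r e f A = r A * f (insert e A) + (1 - r A) * f (A.erase e) := rfl

lemma siteAvg_idem {r : Finset E → ℝ} {e : E} (h1 : ∀ A, r (insert e A) = r A)
    (h2 : ∀ A, r (A.erase e) = r A) : siteAvg r e * siteAvg r e = siteAvg r e := by
  refine LinearMap.ext fun f => funext fun A => ?_
  simp only [Module.End.mul_apply, siteAvg_apply, h1, h2, Finset.insert_idem,
    Finset.erase_insert_eq_erase, Finset.erase_idem,
    show insert e (A.erase e) = insert e A by grind]
  ring

lemma siteAvg_const_commute (p : ℝ) (e e' : E) :
    Commute (siteAvg (fun _ => p) e) (siteAvg (fun _ => p) e') := by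
  rcases eq_or_ne e e' with rfl | hne
  · exact Commute.refl _
  refine LinearMap.ext fun f => funext fun A => ?_
  simp only [Module.End.mul_apply, siteAvg_apply]
  rw [Finset.insert_comm e e', Finset.erase_right_comm (a := e) (b := e'),
    Finset.erase_insert_of_ne hne, Finset.erase_insert_of_ne hne.symm]
  ring

variable [Fintype E]

lemma sum_finset_split (e : E) (F : Finset E → ℝ) :
    ∑ A, F A = ∑ A with e ∉ A, (F A + F (insert e A)) := by
  rw [Finset.sum_add_distrib, ← Finset.sum_filter_add_sum_filter_not Finset.univ (fun A => e ∉ A)]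
  congr 1
  refine Finset.sum_nbij' (fun A => A.erase e) (fun A => insert e A) ?_ ?_ ?_ ?_ ?_ <;>
    simp +contextual [Finset.insert_erase]

variable {w r : Finset E → ℝ} {e : E}

/-- `hb` is detailed balance on each pair {A, A ∪ {e}}, the only configurations that the operator
mixes. -/
lemma siteAvg_selfAdj (h1 : ∀ A, r (insert e A) = r A)
    (hb : ∀ A, e ∉ A → w A * r A = w (insert e A) * (1 - r A)) : SelfAdj w (siteAvg r e) := by
  intro f g
  unfold wip
  rw [sum_finset_split e, sum_finset_split e]
  refine Finset.sum_congr rfl fun A hA => ?_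
  have hA' : e ∉ A := (Finset.mem_filter.1 hA).2
  simp only [siteAvg_apply, h1, Finset.insert_idem, Finset.erase_insert hA',
    Finset.erase_eq_of_notMem hA']
  linear_combination (f A * g (insert e A) - f (insert e A) * g A) * hb A hA'

/-- On each pair {A, A ∪ {e}} this is a two-point variance; balance merges the two contributions
into one square. -/
lemma siteAvg_dirichlet (h1 : ∀ A, r (insert e A) = r A)
    (hb : ∀ A, e ∉ A → w A * r A = w (insert e A) * (1 - r A)) (f : Finset E → ℝ) :
    wip w f (f - siteAvg r e f)
      = ∑ A with e ∉ A, w (insert e A) * (1 - r A) * (f (insert e A) - f A) ^ 2 := by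
  unfold wip
  rw [sum_finset_split e]
  refine Finset.sum_congr rfl fun A hA => ?_
  have hA' : e ∉ A := (Finset.mem_filter.1 hA).2
  simp only [Pi.sub_apply, siteAvg_apply, h1, Finset.insert_idem, Finset.erase_insert hA',
    Finset.erase_eq_of_notMem hA']
  linear_combination (f A * f A - f A * f (insert e A)) * hb A hA'

/-- The operator resampling all elements of `D` independently, each present with
probability `p`. -/
def resample (p : ℝ) (D : Finset E) : Module.End ℝ (Finset E → ℝ) where
  toFun f A := ∑ B : Finset E,
    (if B \ D = A \ D then p ^ (B ∩ D).card * (1 - p) ^ (D \ B).card else 0) * f B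
  map_add' f g := by
    funext A; simp only [Pi.add_apply, mul_add, Finset.sum_add_distrib]
  map_smul' c f := by
    funext A; simp only [Pi.smul_apply, smul_eq_mul, RingHom.id_apply, Finset.mul_sum]
    exact Finset.sum_congr rfl fun _ _ => by ring

lemma resample_apply (p : ℝ) (D : Finset E) (f : Finset E → ℝ) (A : Finset E) :
    resample p D f A = ∑ B : Finset E,
      (if B \ D = A \ D then p ^ (B ∩ D).card * (1 - p) ^ (D \ B).card else 0) * f B := rfl

lemma resample_empty (p : ℝ) : resample p (∅ : Finset E) = 1 := by
  refine LinearMap.ext fun f => funext fun A => ?_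
  simp [resample_apply]

/-- For a given target `B`, only one outcome at `e` is compatible with `B`, so only one of the two
terms of `siteAvg` survives. -/
lemma resample_insert (p : ℝ) (e : E) (D : Finset E) (he : e ∉ D) :
    resample p (insert e D) = siteAvg (fun _ => p) e * resample p D := by
  refine LinearMap.ext fun f => funext fun A => ?_
  simp only [Module.End.mul_apply, siteAvg_apply, resample_apply, Finset.mul_sum]
  rw [← Finset.sum_add_distrib]
  refine Finset.sum_congr rfl fun B _ => ?_
  rw [← mul_assoc, ← mul_assoc, ← add_mul]
  congr 1
  by_cases hB : e ∈ B
  · have c1 : (B \ insert e D = A \ insert e D) ↔ B \ D = insert e A \ D := by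
      simp only [Finset.ext_iff, Finset.mem_sdiff, Finset.mem_insert]
      grind
    have c2 : ¬ B \ D = A.erase e \ D := by
      intro h
      have := Finset.ext_iff.1 h e
      simp [hB, he] at this
    rw [if_neg c2, mul_zero, add_zero, mul_ite, mul_zero]
    refine if_congr c1 ?_ rfl
    have d1 : B ∩ insert e D = insert e (B ∩ D) := by grind
    have d2 : insert e D \ B = D \ B := by grind
    rw [d1, d2, Finset.card_insert_of_notMem (by simp [he])]
    ring
  · have c1 : (B \ insert e D = A \ insert e D) ↔ B \ D = A.erase e \ D := by
      simp only [Finset.ext_iff, Finset.mem_sdiff, Finset.mem_insert, Finset.mem_erase]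
      grind
    have c2 : ¬ B \ D = insert e A \ D := by
      intro h
      have := Finset.ext_iff.1 h e
      simp [hB, he] at this
    rw [if_neg c2, mul_zero, zero_add, mul_ite, mul_zero]
    refine if_congr c1 ?_ rfl
    have d1 : B ∩ insert e D = B ∩ D := by grind
    have d2 : insert e D \ B = insert e (D \ B) := by grind
    rw [d1, d2, Finset.card_insert_of_notMem (by simp [he])]
    ring

/-- Efron–Stein for independent resampling. -/
lemma resample_facts (hw : ∀ A, 0 ≤ w A) (p : ℝ) (D : Finset E)
    (hb : ∀ e ∈ D, ∀ A, e ∉ A → w A * p = w (insert e A) * (1 - p)) :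
    SelfAdj w (resample p D) ∧ ∀ f, wip w f (f - resample p D f)
      ≤ ∑ e ∈ D, ∑ A with e ∉ A, w (insert e A) * (1 - p) * (f (insert e A) - f A) ^ 2 := by
  obtain ⟨-, h1, -, h2⟩ := efron_stein hw (T := siteAvg fun _ => p) (K := resample p)
    (siteAvg_const_commute p) (fun e => siteAvg_idem (fun _ => rfl) fun _ => rfl)
    (resample_empty p) (resample_insert p) D
    (fun e he => siteAvg_selfAdj (fun _ => rfl) (hb e he))
  refine ⟨h1, fun f => (h2 f).trans_eq (Finset.sum_congr rfl fun e he => ?_)⟩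
  exact siteAvg_dirichlet (fun _ => rfl) (hb e he) f

end HeatBath

lemma sum_bernoulli {α : Type*} [Fintype α] [DecidableEq α] {x y : ℝ} (h : x + y = 1) :
    ∑ S : Finset α, x ^ S.card * y ^ (Sᶜ).card = 1 := by
  simp only [Finset.card_compl]
  rw [Fintype.sum_pow_mul_eq_add_pow, h, one_pow]

lemma card_compl_eq_insert {α : Type*} [Fintype α] [DecidableEq α] {c : α} {S : Finset α}
    (hc : c ∉ S) : (Sᶜ).card = ((insert c S)ᶜ).card + 1 := by
  rw [Finset.compl_insert, Finset.card_erase_add_one (Finset.mem_compl.2 hc)]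

lemma sum_bernoulli_mem {α : Type*} [Fintype α] [DecidableEq α] {x y : ℝ} (h : x + y = 1)
    (c : α) : ∑ S : Finset α, x ^ S.card * y ^ (Sᶜ).card * (if c ∈ S then 1 else 0) = x := by
  have h1 := sum_bernoulli (α := α) h
  rw [sum_finset_split c] at h1 ⊢
  have h2 := congrArg (x * ·) h1
  simp only [mul_one, Finset.mul_sum] at h2
  refine Eq.trans ?_ h2
  refine Finset.sum_congr rfl fun S hS => ?_
  have hS' : c ∉ S := (Finset.mem_filter.1 hS).2
  rw [if_neg hS', if_pos (Finset.mem_insert_self _ _), card_compl_eq_insert hS',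
    Finset.card_insert_of_notMem hS']
  obtain rfl : y = 1 - x := by linarith
  ring

/-- Components of different configurations have different types; they are compared as images of a
common set of vertices. -/
lemma card_image_congr {α β γ : Type*} [DecidableEq β] [DecidableEq γ] (s : Finset α)
    (f : α → β) (g : α → γ) (h : ∀ a ∈ s, ∀ b ∈ s, f a = f b ↔ g a = g b) :
    (s.image f).card = (s.image g).card := by
  refine Finset.card_bij' (fun b hb => g (Finset.mem_image.1 hb).choose)
    (fun c hc => f (Finset.mem_image.1 hc).choose) ?_ ?_ ?_ ?_
  · intro b hb
    exact Finset.mem_image_of_mem _ (Finset.mem_image.1 hb).choose_spec.1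
  · intro b hb
    exact Finset.mem_image_of_mem _ (Finset.mem_image.1 hb).choose_spec.1
  · intro b hb
    have h1 := (Finset.mem_image.1 hb).choose_spec
    have hc := Finset.mem_image_of_mem g h1.1
    have h2 := (Finset.mem_image.1 hc).choose_spec
    exact ((h _ h2.1 _ h1.1).2 h2.2).trans h1.2
  · intro b hb
    have h1 := (Finset.mem_image.1 hb).choose_spec
    have hc := Finset.mem_image_of_mem f h1.1
    have h2 := (Finset.mem_image.1 hc).choose_spec
    exact ((h _ h2.1 _ h1.1).1 h2.2).trans h1.2

/-! ### Components, active vertex sets and their probabilities. -/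

section Graph

variable {V : Type*} [Fintype V] [DecidableEq V] {G : SimpleGraph V} [DecidableRel G.Adj]

omit [Fintype V] [DecidableEq V] [DecidableRel G.Adj] in
lemma subgraphOf_adj {A : Config G} {u v : V} :
    (subgraphOf A).Adj u v ↔ ∃ e ∈ A, (e : Sym2 V) = s(u, v) := by
  unfold subgraphOf
  rw [SimpleGraph.fromEdgeSet_adj]
  constructor
  · rintro ⟨⟨e, he, h⟩, -⟩
    exact ⟨e, he, h⟩
  · rintro ⟨e, he, h⟩
    refine ⟨⟨e, he, h⟩, ?_⟩
    have := e.2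
    rw [h, SimpleGraph.mem_edgeSet] at this
    exact this.ne

omit [Fintype V] [DecidableEq V] [DecidableRel G.Adj] in
lemma subgraphOf_mono {A B : Config G} (h : A ⊆ B) : subgraphOf A ≤ subgraphOf B := by
  intro u v
  rw [subgraphOf_adj, subgraphOf_adj]
  exact fun ⟨e, he, h'⟩ => ⟨e, h he, h'⟩

omit [DecidableEq V] [DecidableRel G.Adj] in
lemma numComponents_anti {A B : Config G} (h : A ⊆ B) : numComponents B ≤ numComponents A := by
  refine Nat.card_le_card_of_surjective
    (SimpleGraph.ConnectedComponent.map (SimpleGraph.Hom.ofLE (subgraphOf_mono h))) ?_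
  intro c
  induction c using SimpleGraph.ConnectedComponent.ind with
  | h v => exact ⟨(subgraphOf A).connectedComponentMk v, rfl⟩

omit [DecidableEq V] [DecidableRel G.Adj] in
lemma numComponents_le (A : Config G) : numComponents A ≤ Fintype.card V := by
  rw [← Nat.card_eq_fintype_card]
  refine Nat.card_le_card_of_surjective (subgraphOf A).connectedComponentMk ?_
  intro c
  induction c using SimpleGraph.ConnectedComponent.ind with
  | h v => exact ⟨v, rfl⟩

lemma bernoulli_insert (p : ℝ) {A : Config G} {e : G.edgeSet} (he : e ∉ A) :
    (1 - p) * (p ^ (insert e A).card * (1 - p) ^ ((insert e A)ᶜ).card)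
      = p * (p ^ A.card * (1 - p) ^ (Aᶜ).card) := by
  rw [card_compl_eq_insert he, Finset.card_insert_of_notMem he]
  ring

/-- No edge of `A` leaves `W`, i.e. `W` is a union of components of `(V, A)`. -/
def Separated (A : Config G) (W : Finset V) : Prop :=
  ∀ u v, (subgraphOf A).Adj u v → (u ∈ W ↔ v ∈ W)

omit [Fintype V] [DecidableEq V] [DecidableRel G.Adj] in
lemma Separated.reachable {A : Config G} {W : Finset V} (h : Separated A W) {u v : V}
    (huv : (subgraphOf A).Reachable u v) : u ∈ W ↔ v ∈ W := by
  obtain ⟨w⟩ := huv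
  induction w with
  | nil => rfl
  | cons hadj _ ih => exact (h _ _ hadj).trans ih

/-- The edges of `G` with both endpoints in `W`. -/
def edgesIn (G : SimpleGraph V) [DecidableRel G.Adj] (W : Finset V) : Config G :=
  Finset.univ.filter fun e => ∀ v ∈ (e : Sym2 V), v ∈ W

lemma mem_edgesIn {W : Finset V} {e : G.edgeSet} :
    e ∈ edgesIn G W ↔ ∀ v ∈ (e : Sym2 V), v ∈ W := by simp [edgesIn]

lemma separated_insert {A : Config G} {W : Finset V} {e : G.edgeSet} (he : e ∈ edgesIn G W) :
    Separated (insert e A) W ↔ Separated A W := by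
  constructor
  · exact fun h u v huv => h u v (subgraphOf_mono (Finset.subset_insert _ _) huv)
  · intro h u v huv
    obtain ⟨e', he', heq⟩ := subgraphOf_adj.1 huv
    rcases Finset.mem_insert.1 he' with rfl | he'
    · rw [mem_edgesIn, heq] at he
      simp [he u (by simp), he v (by simp)]
    · exact h u v (subgraphOf_adj.2 ⟨e', he', heq⟩)

lemma reachable_insert {A : Config G} {W : Finset V} {e : G.edgeSet} (he : e ∈ edgesIn G W)
    (hA : Separated A W) {u v : V} (hu : u ∉ W) :
    (subgraphOf (insert e A)).Reachable u v ↔ (subgraphOf A).Reachable u v := by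
  constructor
  · rintro ⟨w⟩
    induction w with
    | nil => exact SimpleGraph.Reachable.refl _
    | @cons a b c hadj _ ih =>
      have hadj' : (subgraphOf A).Adj a b := by
        obtain ⟨e', he', heq⟩ := subgraphOf_adj.1 hadj
        rcases Finset.mem_insert.1 he' with rfl | he'
        · rw [mem_edgesIn, heq] at he
          exact absurd (he a (by simp)) hu
        · exact subgraphOf_adj.2 ⟨e', he', heq⟩
      exact hadj'.reachable.trans (ih fun hb => hu ((hA _ _ hadj').2 hb))
  · exact fun h => h.mono (subgraphOf_mono (Finset.subset_insert _ _))

open Classical in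
/-- The number of components of `(V, A)` meeting `W`. -/
def numMeeting (A : Config G) (W : Finset V) : ℕ :=
  (W.image (subgraphOf A).connectedComponentMk).card

open Classical in
/-- The probability that `W` is the set of active vertices. -/
def activeProb (q : ℝ) (A : Config G) (W : Finset V) : ℝ :=
  if Separated A W then (1 / q) ^ numMeeting A W * (1 - 1 / q) ^ numMeeting A Wᶜ else 0

open Classical in
/-- The vertices in the components belonging to `S`. -/
def activeVerts (A : Config G) (S : Finset (Component A)) : Finset V :=
  Finset.univ.filter fun v => (subgraphOf A).connectedComponentMk v ∈ S

omit [DecidableEq V] [DecidableRel G.Adj] in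
lemma mem_activeVerts {A : Config G} {S : Finset (Component A)} {v : V} :
    v ∈ activeVerts A S ↔ (subgraphOf A).connectedComponentMk v ∈ S := by simp [activeVerts]

open Classical in
omit [DecidableEq V] [DecidableRel G.Adj] in
lemma image_activeVerts (A : Config G) (S : Finset (Component A)) :
    (activeVerts A S).image (subgraphOf A).connectedComponentMk = S := by
  ext c
  induction c using SimpleGraph.ConnectedComponent.ind with
  | h v =>
    simp only [Finset.mem_image, mem_activeVerts]
    exact ⟨fun ⟨u, hu, h⟩ => h ▸ hu, fun h => ⟨v, h, rfl⟩⟩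

omit [DecidableEq V] [DecidableRel G.Adj] in
lemma separated_activeVerts (A : Config G) (S : Finset (Component A)) :
    Separated A (activeVerts A S) := by
  intro u v huv
  rw [mem_activeVerts, mem_activeVerts, SimpleGraph.ConnectedComponent.eq.2 huv.reachable]

open Classical in
omit [DecidableEq V] [DecidableRel G.Adj] in
lemma activeVerts_image {A : Config G} {W : Finset V} (h : Separated A W) :
    activeVerts A (W.image (subgraphOf A).connectedComponentMk) = W := by
  ext v
  rw [mem_activeVerts, Finset.mem_image]
  constructor
  · rintro ⟨u, hu, huv⟩
    exact (h.reachable (SimpleGraph.ConnectedComponent.eq.1 huv)).1 hu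
  · exact fun hv => ⟨v, hv, rfl⟩

omit [DecidableRel G.Adj] in
lemma activeVerts_compl (A : Config G) (S : Finset (Component A)) [DecidableEq (Component A)] :
    activeVerts A Sᶜ = (activeVerts A S)ᶜ := by
  ext v; simp [mem_activeVerts]

omit [DecidableRel G.Adj] in
lemma numMeeting_add {A : Config G} {W : Finset V} (h : Separated A W) :
    numMeeting A W + numMeeting A Wᶜ = numComponents A := by
  classical
  have h1 := activeVerts_image h
  set S := W.image (subgraphOf A).connectedComponentMk with hS
  unfold numMeeting numComponents
  rw [Nat.card_eq_fintype_card, ← Finset.card_add_card_compl S]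
  congr 1
  rw [← h1, ← activeVerts_compl, image_activeVerts]
  congr!

omit [DecidableRel G.Adj] in
open Classical in
-- Sets of components correspond to separated vertex sets. The index type on the right no longer
-- depends on `A`, so the sums over `A` and `W` can be exchanged.
lemma sum_active (q : ℝ) (A : Config G) (F : Finset V → ℝ) :
    ∑ S : Finset (Component A), ((1 / q) ^ S.card * (1 - 1 / q) ^ (Sᶜ).card) * F (activeVerts A S)
      = ∑ W : Finset V, activeProb q A W * F W := by
  have : ∀ W : Finset V, activeProb q A W * F W
      = if Separated A W then
          (1 / q) ^ numMeeting A W * (1 - 1 / q) ^ numMeeting A Wᶜ * F W else 0 := by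
    intro W; unfold activeProb; split_ifs <;> simp
  rw [Finset.sum_congr rfl fun W _ => this W, ← Finset.sum_filter]
  refine Finset.sum_nbij' (activeVerts A)
    (fun W => W.image (subgraphOf A).connectedComponentMk) ?_ ?_ ?_ ?_ ?_
  · intro S _
    simpa using separated_activeVerts A S
  · intro W _
    exact Finset.mem_univ _
  · intro S _
    exact image_activeVerts A S
  · intro W hW
    exact activeVerts_image (Finset.mem_filter.1 hW).2
  · intro S _
    unfold numMeeting
    rw [image_activeVerts, ← activeVerts_compl, image_activeVerts]
    congr!

omit [DecidableRel G.Adj] in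
lemma activeProb_nonneg {q : ℝ} (hq : 1 < q) (A : Config G) (W : Finset V) :
    0 ≤ activeProb q A W := by
  have : 1 / q ≤ 1 := (div_le_one (by linarith)).2 hq.le
  unfold activeProb
  split_ifs
  · have : 0 ≤ 1 - 1 / q := by linarith
    positivity
  · exact le_rfl

omit [DecidableRel G.Adj] in
lemma sum_activeProb (q : ℝ) (A : Config G) : ∑ W : Finset V, activeProb q A W = 1 := by
  have := sum_active q A fun _ => 1
  simp only [mul_one] at this
  rw [← this]
  classical
  convert sum_bernoulli (α := Component A) (x := 1 / q) (y := 1 - 1 / q) (by ring)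

/-- The endpoints of a present edge share a component, so a single activation decides. This is the
source of the gain 1/q. -/
lemma sum_activeProb_mem (q : ℝ) {A : Config G} {e : G.edgeSet} (he : e ∈ A) :
    ∑ W : Finset V, activeProb q A W * (if e ∈ edgesIn G W then 1 else 0) = 1 / q := by
  classical
  rw [← sum_active]
  obtain ⟨e', he'⟩ := e
  induction e' using Sym2.ind with
  | h u v =>
    have huv : (subgraphOf A).connectedComponentMk u = (subgraphOf A).connectedComponentMk v :=
      SimpleGraph.ConnectedComponent.eq.2
        (SimpleGraph.Adj.reachable (subgraphOf_adj.2 ⟨_, he, rfl⟩))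
    refine Eq.trans ?_ (sum_bernoulli_mem (α := Component A) (x := 1 / q) (y := 1 - 1 / q)
      (by ring) ((subgraphOf A).connectedComponentMk u))
    refine Finset.sum_congr rfl fun S _ => ?_
    congr! 2
    simp [mem_edgesIn, mem_activeVerts, ← huv]

/-- The powers of `q` cancel on active components and leave `q - 1` for each inactive one; an edge
inside `W` changes neither the components outside `W` nor separation. -/
lemma pow_mul_activeProb_insert {q : ℝ} (hq : 1 < q) {A : Config G} {W : Finset V}
    {e : G.edgeSet} (he : e ∈ edgesIn G W) :
    q ^ numComponents (insert e A) * activeProb q (insert e A) W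
      = q ^ numComponents A * activeProb q A W := by
  have key : ∀ B : Config G, q ^ numComponents B * activeProb q B W
      = open Classical in if Separated B W then (q - 1) ^ numMeeting B Wᶜ else 0 := by
    intro B
    unfold activeProb
    split_ifs with h
    · have hq0 : q ≠ 0 := by linarith
      rw [← numMeeting_add h, pow_add, show q - 1 = q * (1 - 1 / q) by field_simp, mul_pow,
        mul_mul_mul_comm, ← mul_pow, mul_one_div_cancel hq0, one_pow, one_mul]
    · simp
  rw [key, key]
  by_cases h : Separated A W
  · rw [if_pos h, if_pos ((separated_insert he).2 h)]
    congr 1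
    classical
    refine card_image_congr _ _ _ fun u hu v _ => ?_
    rw [SimpleGraph.ConnectedComponent.eq, SimpleGraph.ConnectedComponent.eq]
    exact reachable_insert he h (Finset.mem_compl.1 hu)
  · rw [if_neg h, if_neg (mt (separated_insert he).1 h)]

end Graph

/-! ### Bounds on the random-cluster measure. -/

section Measure

variable {V : Type*} [Fintype V] [DecidableEq V] (G : SimpleGraph V) [DecidableRel G.Adj]
  {p q : ℝ} (hq : 1 < q) (hp0 : 0 < p) (hp1 : p < 1)

include hq hp0 hp1

lemma weight_pos (A : Config G) : 0 < weight p q A := by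
  have : 0 < 1 - p := by linarith
  unfold weight
  positivity

lemma partitionFunction_pos : 0 < partitionFunction G p q :=
  Finset.sum_pos (fun A _ => weight_pos G hq hp0 hp1 A) Finset.univ_nonempty

lemma rcMeasure_pos (A : Config G) : 0 < rcMeasure G p q A :=
  div_pos (weight_pos G hq hp0 hp1 A) (partitionFunction_pos G hq hp0 hp1)

lemma sum_rcMeasure : ∑ A : Config G, rcMeasure G p q A = 1 := by
  unfold rcMeasure
  rw [← Finset.sum_div]
  exact div_self (partitionFunction_pos G hq hp0 hp1).ne'

lemma partitionFunction_le : partitionFunction G p q ≤ q ^ Fintype.card V := by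
  have h1 : 0 < 1 - p := by linarith
  calc partitionFunction G p q
      ≤ ∑ A : Config G, p ^ A.card * (1 - p) ^ (Aᶜ).card * q ^ Fintype.card V := by
        refine Finset.sum_le_sum fun A _ => ?_
        unfold weight
        gcongr
        · exact hq.le
        · exact numComponents_le A
    _ = q ^ Fintype.card V := by
        rw [← Finset.sum_mul, sum_bernoulli (by ring), one_mul]

lemma le_rcMeasure (A : Config G) :
    p ^ A.card * (1 - p) ^ (Aᶜ).card / q ^ Fintype.card V ≤ rcMeasure G p q A := by
  have h1 : 0 < 1 - p := by linarith
  have h2 : p ^ A.card * (1 - p) ^ (Aᶜ).card ≤ weight p q A :=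
    le_mul_of_one_le_right (by positivity) (one_le_pow₀ hq.le)
  unfold rcMeasure
  exact div_le_div₀ (weight_pos G hq hp0 hp1 A).le h2 (partitionFunction_pos G hq hp0 hp1)
    (partitionFunction_le G hq hp0 hp1)

/-- Adding an edge cannot create components, and `q > 1`. -/
lemma rcMeasure_insert_le {A : Config G} {e : G.edgeSet} (he : e ∉ A) :
    (1 - p) * rcMeasure G p q (insert e A) ≤ p * rcMeasure G p q A := by
  have h1 : 0 < 1 - p := by linarith
  have hZ := partitionFunction_pos G hq hp0 hp1
  have hb := bernoulli_insert p he
  unfold rcMeasure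
  rw [← mul_div_assoc, ← mul_div_assoc]
  refine div_le_div_of_nonneg_right (c := partitionFunction G p q) ?_ hZ.le
  unfold weight
  have hc : q ^ numComponents (insert e A) ≤ q ^ numComponents A :=
    pow_le_pow_right₀ hq.le (numComponents_anti (Finset.subset_insert _ _))
  have hB : 0 ≤ p * (p ^ A.card * (1 - p) ^ (Aᶜ).card) := by positivity
  rw [← mul_assoc, hb]
  exact (mul_le_mul_of_nonneg_left hc hB).trans_eq (mul_assoc _ _ _)

end Measure

/-! ### The two dynamics and the comparison of their Dirichlet forms. -/

section Dynamics

variable {V : Type*} [Fintype V] [DecidableEq V] (G : SimpleGraph V) [DecidableRel G.Adj]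
  {p q : ℝ}

lemma resample_const (p : ℝ) {E : Type*} [DecidableEq E] [Fintype E] (D : Finset E) :
    resample p D (fun _ => 1) = fun _ => 1 := by
  induction D using Finset.induction_on with
  | empty => rw [resample_empty, Module.End.one_apply]
  | insert e D he ih =>
    rw [resample_insert p e D he, Module.End.mul_apply, ih]
    funext A
    simp [siteAvg_apply]

lemma chayesMachta_mulVec (f : Config G → ℝ) (A : Config G) :
    (chayesMachta G p q).mulVec f A
      = ∑ W : Finset V, activeProb q A W * resample p (edgesIn G W) f A := by
  classical
  rw [← sum_active]
  have hE : ∀ S : Finset (Component A), edgesIn G (activeVerts A S) = activeEdges A S := by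
    intro S
    ext e
    simp [mem_edgesIn, mem_activeVerts, activeEdges]
  simp only [Matrix.mulVec, dotProduct, chayesMachta, Finset.sum_mul]
  rw [Finset.sum_comm]
  refine Finset.sum_congr rfl fun S _ => ?_
  rw [hE, resample_apply, Finset.mul_sum]
  refine Finset.sum_congr rfl fun B _ => ?_
  rw [mul_assoc]

/-- The joint weight of the configuration and the set of active vertices. -/
def jointWeight (p q : ℝ) (W : Finset V) (A : Config G) : ℝ :=
  rcMeasure G p q A * activeProb q A W

lemma sum_wip_jointWeight (f g : Config G → ℝ) :
    ∑ W : Finset V, wip (jointWeight G p q W) f g = wip (rcMeasure G p q) f g := by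
  unfold wip jointWeight
  rw [Finset.sum_comm]
  refine Finset.sum_congr rfl fun A _ => ?_
  rw [← Finset.sum_mul, ← Finset.sum_mul, ← Finset.mul_sum, sum_activeProb, mul_one]

lemma wip_chayesMachta (f g : Config G → ℝ) :
    wip (rcMeasure G p q) f ((chayesMachta G p q).mulVec g)
      = ∑ W : Finset V, wip (jointWeight G p q W) f (resample p (edgesIn G W) g) := by
  unfold wip jointWeight
  rw [Finset.sum_comm]
  refine Finset.sum_congr rfl fun A _ => ?_
  rw [chayesMachta_mulVec, Finset.mul_sum]
  exact Finset.sum_congr rfl fun W _ => by ring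

section

variable (hq : 1 < q) (hp0 : 0 < p) (hp1 : p < 1)

include hq hp0 hp1

lemma jointWeight_nonneg (W : Finset V) (A : Config G) : 0 ≤ jointWeight G p q W A :=
  mul_nonneg (rcMeasure_pos G hq hp0 hp1 A).le (activeProb_nonneg hq A W)

omit hp0 hp1 in
-- Given `W`, edges inside `W` see independent percolation: this is the balance condition needed by
-- `resample_facts`.
lemma jointWeight_insert {W : Finset V} {e : G.edgeSet} (heW : e ∈ edgesIn G W) {A : Config G}
    (he : e ∉ A) :
    jointWeight G p q W A * p = jointWeight G p q W (insert e A) * (1 - p) := by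
  have h1 := pow_mul_activeProb_insert hq (A := A) heW
  have h2 := bernoulli_insert p he
  unfold jointWeight rcMeasure weight
  linear_combination (q ^ numComponents A * activeProb q A W / partitionFunction G p q) * (-h2)
    - ((1 - p) * (p ^ (insert e A).card * (1 - p) ^ ((insert e A)ᶜ).card)
      / partitionFunction G p q) * h1

lemma chayesMachta_revChain : RevChain (rcMeasure G p q) (chayesMachta G p q) where
  pos := rcMeasure_pos G hq hp0 hp1
  sum_one := sum_rcMeasure G hq hp0 hp1
  nonneg A B := by
    have h1 : 0 < 1 - p := by linarith
    have h2 : 1 / q ≤ 1 := (div_le_one (by linarith)).2 hq.le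
    have h3 : 0 ≤ 1 - 1 / q := by linarith
    refine Finset.sum_nonneg fun S _ => ?_
    split_ifs <;> positivity
  row_sum A := by
    have := chayesMachta_mulVec G (p := p) (q := q) (fun _ => 1) A
    simp only [resample_const, mul_one, sum_activeProb] at this
    simpa [Matrix.mulVec, dotProduct] using this
  rev := reversible_of_wip fun f g => by
    rw [wip_comm _ (Matrix.mulVec _ _), wip_chayesMachta, wip_chayesMachta]
    refine Finset.sum_congr rfl fun W _ => ?_
    rw [(resample_facts (jointWeight_nonneg G hq hp0 hp1 W) p (edgesIn G W)
      fun e he A hA => jointWeight_insert G hq he hA).1, wip_comm]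

/-- Upper bound on the Dirichlet form of the Chayes–Machta dynamics by single-edge terms. -/
lemma chayesMachta_dirichlet_le (f : Config G → ℝ) :
    wip (rcMeasure G p q) f f - wip (rcMeasure G p q) f ((chayesMachta G p q).mulVec f)
      ≤ ∑ e : G.edgeSet, ∑ A : Config G with e ∉ A,
        1 / q * (rcMeasure G p q (insert e A) * (1 - p) * (f (insert e A) - f A) ^ 2) := by
  rw [wip_chayesMachta, ← sum_wip_jointWeight, ← Finset.sum_sub_distrib]
  calc _ ≤ ∑ W : Finset V, ∑ e ∈ edgesIn G W, ∑ A : Config G with e ∉ A,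
        jointWeight G p q W (insert e A) * (1 - p) * (f (insert e A) - f A) ^ 2 := by
        refine Finset.sum_le_sum fun W _ => ?_
        rw [← wip_sub_right]
        exact (resample_facts (jointWeight_nonneg G hq hp0 hp1 W) p (edgesIn G W)
          fun e he A hA => jointWeight_insert G hq he hA).2 f
    _ = ∑ W : Finset V, ∑ e : G.edgeSet, ∑ A : Config G with e ∉ A,
        (activeProb q (insert e A) W * (if e ∈ edgesIn G W then 1 else 0)) *
          (rcMeasure G p q (insert e A) * (1 - p) * (f (insert e A) - f A) ^ 2) := by
        refine Finset.sum_congr rfl fun W _ => ?_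
        rw [← Finset.sum_filter_add_sum_filter_not Finset.univ (fun e => e ∈ edgesIn G W)]
        rw [Finset.sum_eq_zero (s := Finset.univ.filter fun e => e ∉ edgesIn G W), add_zero,
          Finset.filter_univ_mem]
        · refine Finset.sum_congr rfl fun e he => Finset.sum_congr rfl fun A _ => ?_
          rw [if_pos he]
          unfold jointWeight
          ring
        · intro e he
          simp [(Finset.mem_filter.1 he).2]
    _ = _ := by
        rw [Finset.sum_comm]
        refine Finset.sum_congr rfl fun e _ => ?_
        rw [Finset.sum_comm]
        refine Finset.sum_congr rfl fun A _ => ?_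
        -- The single-edge terms were written at `insert e A`, where `e` is present, so that summing
        -- over `W` gives exactly 1/q.
        rw [← Finset.sum_mul, sum_activeProb_mem q (Finset.mem_insert_self e A)]

end

/-- The conditional probability that the edge `e` is present given all other edges. -/
def insertProb (p q : ℝ) (e : G.edgeSet) (A : Config G) : ℝ :=
  rcMeasure G p q (insert e A) /
    (rcMeasure G p q (insert e A) + rcMeasure G p q (A.erase e))

lemma insertProb_insert (e : G.edgeSet) (A : Config G) :
    insertProb G p q e (insert e A) = insertProb G p q e A := by
  simp [insertProb, Finset.erase_insert_eq_erase]

lemma insertProb_erase (e : G.edgeSet) (A : Config G) :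
    insertProb G p q e (A.erase e) = insertProb G p q e A := by
  simp [insertProb, show insert e (A.erase e) = insert e A by grind]

lemma glauber_mulVec (f : Config G → ℝ) :
    (glauber G p q).mulVec f
      = ∑ e : G.edgeSet, (1 / (Fintype.card G.edgeSet : ℝ)) •
          siteAvg (insertProb G p q e) e f := by
  funext A
  rw [Finset.sum_apply]
  simp only [Matrix.mulVec, dotProduct, glauber, Finset.sum_mul, Pi.smul_apply, smul_eq_mul]
  rw [Finset.sum_comm]
  refine Finset.sum_congr rfl fun e _ => ?_
  simp only [mul_assoc, ← Finset.mul_sum, add_mul, Finset.sum_add_distrib, ite_mul, zero_mul,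
    Finset.sum_ite_eq', Finset.mem_univ, if_true]
  rw [siteAvg_apply]
  rfl

section

variable (hq : 1 < q) (hp0 : 0 < p) (hp1 : p < 1)

include hq hp0 hp1

lemma insertProb_balance {e : G.edgeSet} {A : Config G} (he : e ∉ A) :
    rcMeasure G p q A * insertProb G p q e A
      = rcMeasure G p q (insert e A) * (1 - insertProb G p q e A) := by
  have h1 := rcMeasure_pos G hq hp0 hp1 A
  have h2 := rcMeasure_pos G hq hp0 hp1 (insert e A)
  unfold insertProb
  rw [Finset.erase_eq_of_notMem he]
  field_simp
  ring

lemma insertProb_nonneg (e : G.edgeSet) (A : Config G) : 0 ≤ insertProb G p q e A := by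
  have h1 := rcMeasure_pos G hq hp0 hp1 (A.erase e)
  have h2 := rcMeasure_pos G hq hp0 hp1 (insert e A)
  unfold insertProb
  positivity

lemma insertProb_le (e : G.edgeSet) (A : Config G) : insertProb G p q e A ≤ p := by
  have h1 := rcMeasure_pos G hq hp0 hp1 (A.erase e)
  have h2 := rcMeasure_pos G hq hp0 hp1 (insert e A)
  have h3 := rcMeasure_insert_le G hq hp0 hp1 (A := A.erase e) (e := e) (by simp)
  rw [show insert e (A.erase e) = insert e A by grind] at h3
  unfold insertProb
  rw [div_le_iff₀ (by positivity)]
  linarith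

lemma siteAvg_insertProb_selfAdj (e : G.edgeSet) :
    SelfAdj (rcMeasure G p q) (siteAvg (insertProb G p q e) e) :=
  siteAvg_selfAdj (insertProb_insert G e) fun _ => insertProb_balance G hq hp0 hp1

omit hq hp0 hp1 in
lemma wip_glauber (f g : Config G → ℝ) :
    wip (rcMeasure G p q) f ((glauber G p q).mulVec g)
      = ∑ e : G.edgeSet, 1 / (Fintype.card G.edgeSet : ℝ) *
          wip (rcMeasure G p q) f (siteAvg (insertProb G p q e) e g) := by
  rw [glauber_mulVec]
  simp only [wip, Finset.sum_apply, Finset.mul_sum, Pi.smul_apply, smul_eq_mul]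
  rw [Finset.sum_comm]
  exact Finset.sum_congr rfl fun _ _ => Finset.sum_congr rfl fun _ _ => by ring

lemma glauber_revChain [Nonempty G.edgeSet] : RevChain (rcMeasure G p q) (glauber G p q) where
  pos := rcMeasure_pos G hq hp0 hp1
  sum_one := sum_rcMeasure G hq hp0 hp1
  nonneg A B := by
    refine Finset.sum_nonneg fun e _ => mul_nonneg (by positivity) ?_
    have h1 := insertProb_nonneg G hq hp0 hp1 e A
    have h2 := (insertProb_le G hq hp0 hp1 e A).trans hp1.le
    refine add_nonneg ?_ ?_
    · split_ifs
      exacts [h1, le_rfl]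
    · split_ifs
      exacts [sub_nonneg.2 h2, le_rfl]
  row_sum A := by
    have := congrFun (glauber_mulVec G (p := p) (q := q) (fun _ => 1)) A
    simpa [Matrix.mulVec, dotProduct, siteAvg_apply] using this
  rev := reversible_of_wip fun f g => by
    rw [wip_comm _ (Matrix.mulVec _ _), wip_glauber G, wip_glauber G]
    refine Finset.sum_congr rfl fun e _ => ?_
    rw [siteAvg_insertProb_selfAdj G hq hp0 hp1 e, wip_comm]

/-- Comparison of Dirichlet forms. -/
lemma dirichlet_comparison [Nonempty G.edgeSet] (f : Config G → ℝ) :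
    q / Fintype.card G.edgeSet * (wip (rcMeasure G p q) f f
        - wip (rcMeasure G p q) f ((chayesMachta G p q).mulVec f))
      ≤ wip (rcMeasure G p q) f f - wip (rcMeasure G p q) f ((glauber G p q).mulVec f) := by
  have hm : (0 : ℝ) < Fintype.card G.edgeSet := by exact_mod_cast Fintype.card_pos
  have e1 : wip (rcMeasure G p q) f f
      = ∑ e : G.edgeSet, 1 / (Fintype.card G.edgeSet : ℝ) * wip (rcMeasure G p q) f f := by
    rw [Finset.sum_const, Finset.card_univ, nsmul_eq_mul]
    field_simp
  have e2 : wip (rcMeasure G p q) f f - wip (rcMeasure G p q) f ((glauber G p q).mulVec f)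
      = ∑ e : G.edgeSet, 1 / (Fintype.card G.edgeSet : ℝ) * ∑ A : Config G with e ∉ A,
          rcMeasure G p q (insert e A) * (1 - insertProb G p q e A) *
            (f (insert e A) - f A) ^ 2 := by
    rw [wip_glauber G]
    nth_rewrite 1 [e1]
    rw [← Finset.sum_sub_distrib]
    refine Finset.sum_congr rfl fun e _ => ?_
    rw [← mul_sub, ← wip_sub_right, siteAvg_dirichlet (insertProb_insert G e)
      fun _ => insertProb_balance G hq hp0 hp1]
  rw [e2]
  refine (mul_le_mul_of_nonneg_left (chayesMachta_dirichlet_le G hq hp0 hp1 f)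
    (by positivity)).trans ?_
  rw [Finset.mul_sum]
  refine Finset.sum_le_sum fun e _ => ?_
  rw [Finset.mul_sum, Finset.mul_sum]
  refine Finset.sum_le_sum fun A _ => ?_
  have h1 := rcMeasure_pos G hq hp0 hp1 (insert e A)
  have h2 := insertProb_le G hq hp0 hp1 e A
  have hq0 : q ≠ 0 := by linarith
  calc _ = 1 / (Fintype.card G.edgeSet : ℝ) *
        (rcMeasure G p q (insert e A) * (1 - p) * (f (insert e A) - f A) ^ 2) := by
        field_simp
    -- Uses `h2`: 1 - p is at most the heat-bath removal probability.
    _ ≤ _ := by gcongr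

/-- GD is an average of orthogonal projections, so Jensen applies. Negative eigenvalues are thus
excluded, and the gap alone controls the L² decay. -/
lemma glauber_sq_le [Nonempty G.edgeSet] (f : Config G → ℝ) :
    wip (rcMeasure G p q) ((glauber G p q).mulVec f) ((glauber G p q).mulVec f)
      ≤ wip (rcMeasure G p q) f ((glauber G p q).mulVec f) := by
  have hm : (0 : ℝ) < Fintype.card G.edgeSet := by exact_mod_cast Fintype.card_pos
  calc _ ≤ ∑ e : G.edgeSet, 1 / (Fintype.card G.edgeSet : ℝ) *
        wip (rcMeasure G p q) (siteAvg (insertProb G p q e) e f)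
          (siteAvg (insertProb G p q e) e f) := by
        rw [glauber_mulVec]
        simp only [wip, Finset.mul_sum]
        rw [Finset.sum_comm]
        refine Finset.sum_le_sum fun A _ => ?_
        have hs := sq_sum_le_card_mul_sum_sq (s := Finset.univ)
          (f := fun e : G.edgeSet => siteAvg (insertProb G p q e) e f A)
        rw [Finset.card_univ] at hs
        have hA := rcMeasure_pos G hq hp0 hp1 A
        simp only [Finset.sum_apply, Pi.smul_apply, smul_eq_mul, ← Finset.mul_sum]
        calc _ = rcMeasure G p q A * (1 / (Fintype.card G.edgeSet : ℝ)) ^ 2 *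
              (∑ e : G.edgeSet, siteAvg (insertProb G p q e) e f A) ^ 2 := by ring
          _ ≤ rcMeasure G p q A * (1 / (Fintype.card G.edgeSet : ℝ)) ^ 2 *
              (Fintype.card G.edgeSet *
                ∑ e : G.edgeSet, siteAvg (insertProb G p q e) e f A ^ 2) := by gcongr
          _ = 1 / (Fintype.card G.edgeSet : ℝ) * (rcMeasure G p q A *
                ∑ e : G.edgeSet, siteAvg (insertProb G p q e) e f A ^ 2) := by field_simp
          _ = _ := by
            rw [Finset.mul_sum]
            congr 1
            exact Finset.sum_congr rfl fun e _ => by ring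
    _ = _ := by
        rw [wip_glauber G]
        refine Finset.sum_congr rfl fun e _ => ?_
        rw [(siteAvg_insertProb_selfAdj G hq hp0 hp1 e).wip_idem
          (siteAvg_idem (insertProb_insert G e) (insertProb_erase G e))]

/-- Mean-square contraction of the Glauber dynamics in terms of the Chayes–Machta dynamics. -/
lemma glauber_contraction [Nonempty G.edgeSet] {t : ℕ} (ht : 1 ≤ t)
    (hd : ∀ A, tvDist (fun B => (chayesMachta G p q ^ t) A B) (rcMeasure G p q) ≤ 1 / 4)
    {f : Config G → ℝ} (hf : ∑ A, rcMeasure G p q A * f A = 0) :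
    wip (rcMeasure G p q) ((glauber G p q).mulVec f) ((glauber G p q).mulVec f)
      ≤ Real.exp (-(q / (2 * Fintype.card G.edgeSet * t))) * wip (rcMeasure G p q) f f := by
  have hm : (0 : ℝ) < Fintype.card G.edgeSet := by exact_mod_cast Fintype.card_pos
  have ht' : (0 : ℝ) < t := by exact_mod_cast ht
  have h1 := (chayesMachta_revChain G hq hp0 hp1).gap_of_tvDist ht hd hf
  have h2 := dirichlet_comparison G hq hp0 hp1 f
  have h3 := glauber_sq_le G hq hp0 hp1 f
  have h0 := wip_self_nonneg (fun A => (rcMeasure_pos G hq hp0 hp1 A).le) f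
  have h4 : q / Fintype.card G.edgeSet * (1 / (2 * t) * wip (rcMeasure G p q) f f)
      ≤ q / Fintype.card G.edgeSet * (wip (rcMeasure G p q) f f
        - wip (rcMeasure G p q) f ((chayesMachta G p q).mulVec f)) := by
    refine mul_le_mul_of_nonneg_left ?_ (by positivity)
    linarith
  have h5 : q / Fintype.card G.edgeSet * (1 / (2 * t) * wip (rcMeasure G p q) f f)
      = q / (2 * Fintype.card G.edgeSet * t) * wip (rcMeasure G p q) f f := by
    field_simp
  have h6 := Real.add_one_le_exp (-(q / (2 * Fintype.card G.edgeSet * t)))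
  have h7 := mul_le_mul_of_nonneg_right h6 h0
  linarith

end

end Dynamics

/-! ### Burn-in: the edge count drops to order pm. -/

section BurnIn

variable {V : Type*} [Fintype V] [DecidableEq V] (G : SimpleGraph V) [DecidableRel G.Adj]
  {p q : ℝ} (hq : 1 < q) (hp0 : 0 < p) (hp1 : p < 1)

include hq hp0 hp1

/-- The chosen edge is forgotten and reinserted with probability at most `p`; the recursion has
fixed point pm. -/
lemma glauber_card_le [Nonempty G.edgeSet] (A : Config G) :
    (glauber G p q).mulVec (fun B => (B.card : ℝ)) A
      ≤ (1 - 1 / (Fintype.card G.edgeSet : ℝ)) * A.card + p := by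
  have hm : (0 : ℝ) < Fintype.card G.edgeSet := by exact_mod_cast Fintype.card_pos
  rw [glauber_mulVec, Finset.sum_apply]
  calc _ ≤ ∑ e : G.edgeSet, 1 / (Fintype.card G.edgeSet : ℝ) *
        (A.card - (if e ∈ A then 1 else 0) + p) := by
        refine Finset.sum_le_sum fun e _ => ?_
        rw [Pi.smul_apply, smul_eq_mul]
        refine mul_le_mul_of_nonneg_left ?_ (by positivity)
        rw [siteAvg_apply]
        have h := insertProb_le G hq hp0 hp1 e A
        by_cases he : e ∈ A
        · rw [if_pos he, Finset.insert_eq_of_mem he, ← Finset.card_erase_add_one he]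
          push_cast
          linarith
        · rw [if_neg he, Finset.erase_eq_of_notMem he, Finset.card_insert_of_notMem he]
          push_cast
          linarith
    _ = _ := by
        rw [← Finset.mul_sum, Finset.sum_add_distrib, Finset.sum_sub_distrib, Finset.sum_const,
          Finset.sum_const, Finset.card_univ, Finset.sum_boole, Finset.filter_univ_mem]
        simp only [nsmul_eq_mul]
        field_simp

lemma glauber_pow_card_le [Nonempty G.edgeSet] (t : ℕ) (A : Config G) :
    (glauber G p q ^ t).mulVec (fun B => (B.card : ℝ)) A
      ≤ p * Fintype.card G.edgeSet + (1 - 1 / (Fintype.card G.edgeSet : ℝ)) ^ t * A.card := by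
  have hm : (1 : ℝ) ≤ Fintype.card G.edgeSet := by exact_mod_cast Fintype.card_pos
  have hm' : 0 ≤ 1 - 1 / (Fintype.card G.edgeSet : ℝ) := by
    rw [sub_nonneg, div_le_one (by linarith)]; exact hm
  have hP := glauber_revChain G hq hp0 hp1
  induction t with
  | zero =>
    rw [pow_zero, pow_zero, Matrix.one_mulVec, one_mul]
    have : 0 ≤ p * Fintype.card G.edgeSet := by positivity
    linarith
  | succ t ih =>
    have ht := hP.pow t
    rw [pow_succ, ← Matrix.mulVec_mulVec]
    calc _ ≤ (glauber G p q ^ t).mulVec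
          (fun B => (1 - 1 / (Fintype.card G.edgeSet : ℝ)) * (B.card : ℝ) + p) A :=
          Finset.sum_le_sum fun B _ => mul_le_mul_of_nonneg_left
            (glauber_card_le G hq hp0 hp1 B) (ht.nonneg A B)
      _ = (1 - 1 / (Fintype.card G.edgeSet : ℝ)) *
            (glauber G p q ^ t).mulVec (fun B => (B.card : ℝ)) A + p := by
          simp only [Matrix.mulVec, dotProduct, mul_add, Finset.sum_add_distrib]
          rw [← Finset.sum_mul, ht.row_sum, one_mul, Finset.mul_sum]
          congr 1
          exact Finset.sum_congr rfl fun B _ => by ring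
      _ ≤ (1 - 1 / (Fintype.card G.edgeSet : ℝ)) * (p * Fintype.card G.edgeSet
            + (1 - 1 / (Fintype.card G.edgeSet : ℝ)) ^ t * A.card) + p := by gcongr
      _ = _ := by
          have : 1 / (Fintype.card G.edgeSet : ℝ) * Fintype.card G.edgeSet = 1 :=
            one_div_mul_cancel (by linarith)
          rw [pow_succ]
          linear_combination (-p) * this

/-- After `m log (16 m)` steps the number of edges is at most `16 p m` with probability at
least `7 / 8`. -/
lemma glauber_burnIn [Nonempty G.edgeSet] {t : ℕ}
    (ht : Fintype.card G.edgeSet * Real.log (16 * Fintype.card G.edgeSet) ≤ t) (A : Config G) :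
    ∑ B : Config G with ¬ ((B.card : ℝ) ≤ 16 * p * Fintype.card G.edgeSet),
      (glauber G p q ^ t) A B ≤ 1 / 8 := by
  have hP := (glauber_revChain G hq hp0 hp1).pow t
  have hcard := glauber_pow_card_le G hq hp0 hp1 t A
  have hA : (A.card : ℝ) ≤ Fintype.card G.edgeSet := by exact_mod_cast A.card_le_univ
  have hm : (1 : ℝ) ≤ Fintype.card G.edgeSet := by exact_mod_cast Fintype.card_pos
  set m : ℝ := (Fintype.card G.edgeSet : ℝ) with hmdef
  have hm0 : 0 < m := by linarith
  have hm' : 0 ≤ 1 - 1 / m := by rw [sub_nonneg, div_le_one hm0]; exact hm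
  have hdecay : (1 - 1 / m) ^ t * A.card ≤ 1 / 16 := by
    have h1 : (1 - 1 / m) ^ t ≤ 1 / (16 * m) := by
      calc (1 - 1 / m) ^ t ≤ Real.exp (-(1 / m)) ^ t := by
            gcongr
            have := Real.add_one_le_exp (-(1 / m))
            linarith
        _ = Real.exp (-(t / m)) := by rw [← Real.exp_nat_mul]; congr 1; ring
        _ ≤ Real.exp (-Real.log (16 * m)) := by
            gcongr
            rw [le_div_iff₀ hm0]; linarith
        _ = 1 / (16 * m) := by rw [Real.exp_neg, Real.exp_log (by positivity), one_div]
    calc (1 - 1 / m) ^ t * A.card ≤ 1 / (16 * m) * m := by gcongr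
      _ = 1 / 16 := by field_simp
  have hmean : ∑ B : Config G, (glauber G p q ^ t) A B * (B.card : ℝ) ≤ p * m + 1 / 16 :=
    hcard.trans (by linarith)
  have markov : ∀ c : ℝ, (∀ B : Config G, ¬ ((B.card : ℝ) ≤ 16 * p * m) → 1 ≤ c * B.card) →
      0 ≤ c → ∑ B : Config G with ¬ ((B.card : ℝ) ≤ 16 * p * m), (glauber G p q ^ t) A B
        ≤ c * (p * m + 1 / 16) := by
    intro c hc hc0
    refine le_trans ?_ (mul_le_mul_of_nonneg_left hmean hc0)
    rw [Finset.mul_sum]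
    refine (Finset.sum_le_sum fun B hB => ?_).trans
      (Finset.sum_le_sum_of_subset_of_nonneg (Finset.filter_subset _ _)
        fun B _ _ => mul_nonneg hc0 (mul_nonneg (hP.nonneg A B) (Nat.cast_nonneg _)))
    have := mul_le_mul_of_nonneg_left (hc B (Finset.mem_filter.1 hB).2) (hP.nonneg A B)
    linarith
  have hpm : 0 < p * m := by positivity
  -- If pm ≤ 1/16, a bad configuration still has at least one edge, and the mean is at most 1/8;
  -- otherwise the mean is at most 2pm and Markov at level 16pm applies.
  rcases le_total (p * m) (1 / 16) with h | h
  · refine (markov 1 (fun B hB => ?_) zero_le_one).trans (by linarith)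
    have h1 : 0 < (B.card : ℝ) := by
      push Not at hB
      refine lt_of_le_of_lt ?_ hB
      positivity
    have h2 : 1 ≤ B.card := by exact_mod_cast h1
    rw [one_mul]
    exact_mod_cast h2
  · refine (markov (1 / (16 * (p * m))) (fun B hB => ?_) (by positivity)).trans ?_
    · push Not at hB
      rw [div_mul_eq_mul_div, le_div_iff₀ (by positivity)]
      linarith
    · rw [div_mul_eq_mul_div, div_le_iff₀ (by positivity)]
      linarith

end BurnIn

/-! ### Weight of sparse configurations and the final estimate. -/

section Final

lemma log_inv_min_ge {p : ℝ} (hp0 : 0 < p) (hp1 : p < 1) :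
    1 / 2 ≤ Real.log (1 / min p (1 - p)) := by
  have h0 : 0 < min p (1 - p) := lt_min hp0 (by linarith)
  have h1 : min p (1 - p) ≤ 1 / 2 := by
    rcases le_total p (1 / 2) with h | h
    · exact (min_le_left _ _).trans h
    · exact (min_le_right _ _).trans (by linarith)
  have h2 : 2 ≤ 1 / min p (1 - p) := by rw [le_div_iff₀ h0]; linarith
  have h3 := Real.log_le_log (by norm_num) h2
  linarith [Real.log_two_gt_d9]

/-- Configurations with few edges do not have too small Bernoulli weight. -/
lemma exp_le_bernoulli {p : ℝ} (hp0 : 0 < p) (hp1 : p < 1) {k l : ℕ}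
    (hk : (k : ℝ) ≤ 16 * p * (k + l : ℕ)) :
    Real.exp (-(20 * p * (k + l : ℕ) * Real.log (1 / min p (1 - p)))) ≤ p ^ k * (1 - p) ^ l := by
  have hq0 : 0 < 1 - p := by linarith
  have hL := log_inv_min_ge hp0 hp1
  set L := Real.log (1 / min p (1 - p)) with hLdef
  have hpow : p ^ k * (1 - p) ^ l = Real.exp (k * Real.log p + l * Real.log (1 - p)) := by
    rw [Real.exp_add, Real.exp_nat_mul, Real.exp_nat_mul, Real.exp_log hp0, Real.exp_log hq0]
  rw [hpow]
  refine Real.exp_le_exp.2 ?_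
  push_cast at hk ⊢
  have hk0 : (0 : ℝ) ≤ k := Nat.cast_nonneg k
  have hl0 : (0 : ℝ) ≤ l := Nat.cast_nonneg l
  rcases le_total p (1 / 2) with h | h
  · have e : L = -Real.log p := by
      rw [hLdef, min_eq_left (by linarith), one_div, Real.log_inv]
    have h1 := Real.one_sub_inv_le_log_of_pos hq0
    have h2 : -(2 * p) ≤ 1 - (1 - p)⁻¹ := by
      rw [← sub_nonneg]
      have : 1 - (1 - p)⁻¹ - -(2 * p) = p * (1 - 2 * p) / (1 - p) := by field_simp; ring
      rw [this]
      exact div_nonneg (mul_nonneg hp0.le (by linarith)) hq0.le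
    -- From log(1-p) ≥ -2p and L ≥ 1/2. The constant 20 is 16 from the present edges plus this 4
    -- from the absent ones.
    have h3 : -(4 * p * L) ≤ Real.log (1 - p) := by nlinarith
    have h4 : (l : ℝ) * (-(4 * p * L)) ≤ l * Real.log (1 - p) :=
      mul_le_mul_of_nonneg_left h3 hl0
    have h5 : (k : ℝ) * L ≤ 16 * p * (k + l) * L := mul_le_mul_of_nonneg_right hk (by linarith)
    have h6 : 0 ≤ 4 * p * k * L := by positivity
    rw [show Real.log p = -L by linarith]
    nlinarith
  · have e : L = -Real.log (1 - p) := by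
      rw [hLdef, min_eq_right (by linarith), one_div, Real.log_inv]
    have h1 : -L ≤ Real.log p := by
      rw [e, neg_neg]; exact Real.log_le_log hq0 (by linarith)
    have h2 : (k : ℝ) * (-L) ≤ k * Real.log p := mul_le_mul_of_nonneg_left h1 hk0
    have h3 : (k + l : ℝ) * L * 1 ≤ (k + l : ℝ) * L * (20 * p) :=
      mul_le_mul_of_nonneg_left (by linarith) (by positivity)
    rw [show Real.log (1 - p) = -L by linarith]
    linarith

lemma log_sixteen_le : Real.log 16 ≤ 3 := by
  rw [show (16 : ℝ) = 2 ^ 4 by norm_num, Real.log_pow]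
  have := Real.log_two_lt_d9
  push_cast
  linarith

variable {V : Type*} [Fintype V] [DecidableEq V] (G : SimpleGraph V) [DecidableRel G.Adj]
  {p q : ℝ} (hq : 1 < q) (hp0 : 0 < p) (hp1 : p < 1)

include hq hp0 hp1

lemma exp_le_rcMeasure {A : Config G} (hA : (A.card : ℝ) ≤ 16 * p * Fintype.card G.edgeSet) :
    Real.exp (-(Fintype.card V * q
      + 20 * p * Fintype.card G.edgeSet * Real.log (1 / min p (1 - p)))) ≤ rcMeasure G p q A := by
  refine le_trans ?_ (le_rcMeasure G hq hp0 hp1 A)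
  have hc : Fintype.card G.edgeSet = A.card + (Aᶜ).card := (Finset.card_add_card_compl A).symm
  rw [neg_add, add_comm, Real.exp_add, div_eq_mul_inv]
  -- The crude log q ≤ q suffices, because the gap of GD carries a factor `q`.
  have h1 : Real.exp (-(Fintype.card V * q)) ≤ (q ^ Fintype.card V)⁻¹ := by
    rw [Real.exp_neg, Real.exp_nat_mul]
    have := Real.add_one_le_exp q
    gcongr
    linarith
  rw [hc] at hA ⊢
  exact mul_le_mul (exp_le_bernoulli hp0 hp1 hA) h1 (Real.exp_pos _).le
    (mul_nonneg (by positivity) (pow_nonneg (by linarith) _))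

/-- The mixing time of the Glauber dynamics after a burn-in phase of length `s`. -/
lemma glauber_mixingTime_le [Nonempty G.edgeSet] {τ : ℕ} (hτ : 1 ≤ τ)
    (hd : ∀ A, tvDist (fun B => (chayesMachta G p q ^ τ) A B) (rcMeasure G p q) ≤ 1 / 4)
    {s t : ℕ} (hs : Fintype.card G.edgeSet * Real.log (16 * Fintype.card G.edgeSet) ≤ s)
    (ht : 2 * Fintype.card G.edgeSet * τ * (3 + Fintype.card V
      + 20 * p * Fintype.card G.edgeSet * Real.log (1 / min p (1 - p))) ≤ t) :
    mixingTime (glauber G p q) (rcMeasure G p q) (1 / 4) ≤ (s + t : ℕ) := by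
  classical
  have hP := glauber_revChain G hq hp0 hp1
  have hL := log_inv_min_ge hp0 hp1
  have hm : (0 : ℝ) < Fintype.card G.edgeSet := by exact_mod_cast Fintype.card_pos
  have hτ0 : (0 : ℝ) < τ := by exact_mod_cast hτ
  refine RevChain.mixingTime_le fun A => ?_
  have hgood : ∀ B : Config G, (B.card : ℝ) ≤ 16 * p * Fintype.card G.edgeSet →
      tvDist (fun D => (glauber G p q ^ t) B D) (rcMeasure G p q) ≤ 1 / 8 := by
    intro B hB
    have h1 := hP.sq_tvDist_le (Real.exp_pos _).le
      (fun f hf => glauber_contraction G hq hp0 hp1 hτ hd hf) t B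
    have h2 := exp_le_rcMeasure G hq hp0 hp1 hB
    set m : ℝ := (Fintype.card G.edgeSet : ℝ)
    set n : ℝ := (Fintype.card V : ℝ)
    set L := Real.log (1 / min p (1 - p))
    -- This bounds (2·TV)², so TV ≤ 1/8; the burn-in failure contributes the other 1/8. The 3 in the
    -- choice of `t` covers log 16.
    have h3 : Real.exp (-(q / (2 * m * τ))) ^ t / rcMeasure G p q B ≤ (1 / 4) ^ 2 := by
      rw [div_le_iff₀ (rcMeasure_pos G hq hp0 hp1 B)]
      refine le_trans ?_ (mul_le_mul_of_nonneg_left h2 (by norm_num))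
      rw [show ((1 : ℝ) / 4) ^ 2 = Real.exp (-Real.log 16) by
        rw [Real.exp_neg, Real.exp_log (by norm_num)]; norm_num, ← Real.exp_add,
        ← Real.exp_nat_mul]
      refine Real.exp_le_exp.2 ?_
      have h4 : q * (3 + n + 20 * p * m * L) ≤ t * (q / (2 * m * τ)) := by
        rw [mul_div_assoc', le_div_iff₀ (by positivity)]
        have := mul_le_mul_of_nonneg_left ht (show 0 ≤ q by linarith)
        linarith
      have h5 : 0 ≤ 3 + 20 * p * m * L := by positivity
      have h6 := mul_le_mul_of_nonneg_right hq.le h5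
      have h7 := log_sixteen_le
      linarith
    have h4 := abs_le_of_sq_le_sq (h1.trans h3) (by norm_num)
    linarith [(abs_le.1 h4).2]
  have := hP.tvDist_pow_add_le (fun B : Config G => (B.card : ℝ) ≤ 16 * p * Fintype.card G.edgeSet)
    (by norm_num) A (glauber_burnIn G hq hp0 hp1 hs A) hgood
  exact this.trans (by norm_num)

omit [DecidableEq V] hq in
lemma burnIn_add_le [Nonempty G.edgeSet] {τ : ℕ} (hτ : 1 ≤ τ) :
    ∃ s t : ℕ, Fintype.card G.edgeSet * Real.log (16 * Fintype.card G.edgeSet) ≤ s ∧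
      2 * Fintype.card G.edgeSet * τ * (3 + Fintype.card V
        + 20 * p * Fintype.card G.edgeSet * Real.log (1 / min p (1 - p))) ≤ t ∧
      ((s + t : ℕ) : ℝ) ≤ 100 * ((Fintype.card G.edgeSet : ℝ) * Fintype.card V *
          Real.log (Fintype.card V) + p * (Fintype.card G.edgeSet : ℝ) ^ 2 *
          Real.log (Fintype.card V) * Real.log (1 / min p (1 - p))) * τ := by
  have hL := log_inv_min_ge hp0 hp1
  have hm : (1 : ℝ) ≤ Fintype.card G.edgeSet := by exact_mod_cast Fintype.card_pos
  have hτ0 : (1 : ℝ) ≤ τ := by exact_mod_cast hτ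
  have hn : 2 ≤ Fintype.card V := by
    obtain ⟨e⟩ := ‹Nonempty G.edgeSet›
    obtain ⟨e, he⟩ := e
    induction e using Sym2.ind with
    | h u v => exact Fintype.one_lt_card_iff.2 ⟨u, v, SimpleGraph.Adj.ne he⟩
  have hmn : (Fintype.card G.edgeSet : ℝ) ≤ (Fintype.card V : ℝ) ^ 2 := by
    have h1 := G.card_edgeFinset_le_card_choose_two
    rw [SimpleGraph.edgeFinset_card] at h1
    have h2 := Nat.choose_le_pow (Fintype.card V) 2
    exact_mod_cast h1.trans h2
  have hn' : (2 : ℝ) ≤ Fintype.card V := by exact_mod_cast hn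
  set m : ℝ := (Fintype.card G.edgeSet : ℝ)
  set n : ℝ := (Fintype.card V : ℝ)
  set L := Real.log (1 / min p (1 - p))
  have hl : 1 / 2 ≤ Real.log n := by
    have := Real.log_le_log (by norm_num) hn'
    linarith [Real.log_two_gt_d9]
  have hlogm : Real.log (16 * m) ≤ 3 + 2 * Real.log n := by
    rw [Real.log_mul (by norm_num) (by linarith)]
    have := Real.log_le_log (by linarith) hmn
    rw [Real.log_pow] at this
    push_cast at this
    linarith [log_sixteen_le]
  set l := Real.log n
  have hlm0 : 0 ≤ Real.log (16 * m) := Real.log_nonneg (by linarith)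
  refine ⟨⌈m * Real.log (16 * m)⌉₊, ⌈2 * m * τ * (3 + n + 20 * p * m * L)⌉₊,
    Nat.le_ceil _, Nat.le_ceil _, ?_⟩
  have hs := Nat.ceil_lt_add_one (show 0 ≤ m * Real.log (16 * m) by positivity)
  have ht := Nat.ceil_lt_add_one (show 0 ≤ 2 * m * τ * (3 + n + 20 * p * m * L) by positivity)
  push_cast
  have x1 : 1 ≤ m * τ := by nlinarith
  have x2 : m * τ ≤ m * τ * (n * l) := le_mul_of_one_le_right (by linarith) (by nlinarith)
  have x3 : m * Real.log (16 * m) ≤ m * (3 + 2 * l) := by gcongr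
  have x4 : m * (3 + 2 * l) ≤ m * τ * (3 + n * l) := by
    rw [mul_assoc]
    refine mul_le_mul_of_nonneg_left ?_ (by linarith)
    have y1 : 2 * l ≤ n * l := by gcongr
    have y2 : 3 + n * l ≤ τ * (3 + n * l) := le_mul_of_one_le_left (by positivity) hτ0
    linarith
  -- Since n ≥ 2, 1 ≤ 2 log n inserts the logarithm, which the spectral part does not need.
  have x5 : m * τ * n ≤ 2 * (m * τ * (n * l)) := by
    have : m * τ * n * 1 ≤ m * τ * n * (2 * l) := by
      apply mul_le_mul_of_nonneg_left <;> [linarith; positivity]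
    linarith
  have x6 : m * τ * (p * m * L) ≤ 2 * (m * τ * (p * m * L) * l) := by
    have : m * τ * (p * m * L) * 1 ≤ m * τ * (p * m * L) * (2 * l) := by
      apply mul_le_mul_of_nonneg_left <;> [linarith; positivity]
    linarith
  have x7 : 0 ≤ m * τ * (p * m * L) * l := by positivity
  have e : 100 * (m * n * l + p * m ^ 2 * l * L) * τ
      = 100 * (m * τ * (n * l)) + 100 * (m * τ * (p * m * L) * l) := by ring
  rw [e]
  linarith

end Final

end RandomCluster
end

theorem mainTheorem2 :
    ∃ C : ℝ, 0 < C ∧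
      ∀ (V : Type*) [Fintype V] [DecidableEq V] (G : SimpleGraph V) [DecidableRel G.Adj]
        (q p : ℝ), 1 < q → 0 < p → p < 1 →
        ∀ n m : ℕ, n = Fintype.card V → m = G.edgeFinset.card →
          (RandomCluster.mixingTime (RandomCluster.glauber G p q)
              (RandomCluster.rcMeasure G p q) (1 / 4) : ℝ≥0∞) ≤
            ENNReal.ofReal (C * ((m : ℝ) * n * Real.log n +
                p * (m : ℝ) ^ 2 * Real.log n * Real.log (1 / min p (1 - p)))) *
              (RandomCluster.mixingTime (RandomCluster.chayesMachta G p q)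
                (RandomCluster.rcMeasure G p q) (1 / 4) : ℝ≥0∞) := by
  refine ⟨100, by norm_num, ?_⟩
  intro V _ _ G _ q p hq hp0 hp1 n m hn hm
  rw [SimpleGraph.edgeFinset_card] at hm
  subst hn hm
  have hCM := RandomCluster.chayesMachta_revChain G hq hp0 hp1
  rcases isEmpty_or_nonempty G.edgeSet with hE | hE
  -- Without edges `glauber` is an empty sum, hence the zero matrix, but there is one configuration
  -- and time 0 suffices.
  · have h0 : RandomCluster.mixingTime (RandomCluster.glauber G p q)
        (RandomCluster.rcMeasure G p q) (1 / 4) ≤ (0 : ℕ) := by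
      refine RandomCluster.RevChain.mixingTime_le fun A => ?_
      have h1 := hCM.sum_one
      rw [Fintype.sum_subsingleton _ A] at h1
      unfold RandomCluster.tvDist
      rw [Fintype.sum_subsingleton _ A, h1, pow_zero]
      simp
    rw [show RandomCluster.mixingTime (RandomCluster.glauber G p q)
        (RandomCluster.rcMeasure G p q) (1 / 4) = 0 from le_antisymm h0 zero_le]
    simp
  · have hne := hCM.mixingTime_ne_zero
    -- Taking τ = 1 serves only to show that the coefficient is positive, so that its product with
    -- an infinite mixing time is infinite.
    obtain ⟨s, t, hs, ht, hst⟩ := RandomCluster.burnIn_add_le G hp0 hp1 (le_refl 1)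
    rcases eq_or_ne (RandomCluster.mixingTime (RandomCluster.chayesMachta G p q)
      (RandomCluster.rcMeasure G p q) (1 / 4)) ⊤ with htop | hfin
    · rw [htop, ENat.toENNReal_top, ENNReal.mul_top]
      · exact le_top
      · rw [ne_eq, ENNReal.ofReal_eq_zero, not_le]
        have h1 : (1 : ℝ) ≤ Fintype.card G.edgeSet := by exact_mod_cast Fintype.card_pos
        have h2 : 0 ≤ Real.log (16 * Fintype.card G.edgeSet) := Real.log_nonneg (by linarith)
        have hL := RandomCluster.log_inv_min_ge hp0 hp1
        have h3 : 0 < (t : ℝ) := lt_of_lt_of_le (by positivity) ht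
        push_cast at hst
        have h4 : (0 : ℝ) ≤ s := Nat.cast_nonneg s
        linarith
    · obtain ⟨τ, hτ⟩ := ENat.ne_top_iff_exists.1 hfin
      have hτ1 : 1 ≤ τ := by
        rw [← hτ] at hne
        exact Nat.one_le_iff_ne_zero.2 (by exact_mod_cast hne)
      obtain ⟨s, t, hs, ht, hst⟩ := RandomCluster.burnIn_add_le G hp0 hp1 hτ1
      have hmix := RandomCluster.glauber_mixingTime_le G hq hp0 hp1 hτ1
        (hCM.tvDist_le_of_mixingTime_le hτ.ge) hs ht
      rw [← hτ, ENat.toENNReal_coe]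
      calc _ ≤ (((s + t : ℕ) : ℕ∞) : ℝ≥0∞) := ENat.toENNReal_le.2 hmix
        _ = ENNReal.ofReal ((s + t : ℕ) : ℝ) := by
          rw [ENat.toENNReal_coe, ENNReal.ofReal_natCast]
        _ ≤ _ := ENNReal.ofReal_le_ofReal hst
        _ = _ := by
          rw [ENNReal.ofReal_mul' (Nat.cast_nonneg τ), ENNReal.ofReal_natCast]
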